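/- There is an absolute constant $C>0$ such that the following holds. Let $\kappa\le -1$ and let $$\alpha\;\ge\; \frac{C\,e^{\kappa^2/2}\,\max\{1,\log^2|\kappa|\}}{|\kappa|}.$$ For each $N$ let $G=G_N$ be an $M_N\times N$ matrix with i.i.d. standard Gaussian entries and rows $g_1,\dots,g_{M_N}$, where $M_N/N\to\alpha$ as $N\to\infty$. Call $\sigma\in\{-1,1\}^N$ a solution of the Ising perceptron with $I=[\kappa,\infty)$ if $\langle g_i,\sigma\rangle/\sqrt N\ge\kappa$ for all $1\le i\le M_N$. Let $D_N$ be non-negative integers with $D_N=o(N/\log N)$. For each $N$ let $\omega$ be a random variable, independent of $G_N$, with values in a probability space $\Omega_N$, and let $\mathcal A_N^\circ:\mathbb R^{M_N\times N}\times\Omega_N\to\mathbb R^N$ be a measurable map such that, for each fixed $\omega$, each of the $N$ coordinates of $\mathcal A_N^\circ(\cdot,\omega)$ is a polynomial of degree at most $D_N$ in the entries of the matrix. Suppose that for some constant $B$ independent of $N$ we have $\mathbb E\big[\|\mathcal A_N^\circ(G_N,\omega)\|^2\big]\le BN$ for all large $N$, where $\|\cdot\|$ is the Euclidean norm. Let $\vec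 U=(U_1,\dots,U_N)$ be i.i.d. uniform on $[-1,1]$, independent of $(G_N,\omega)$, and let $\mathcal A_N(G_N,\omega,\vec U)\in\{-1,1\}^N$ be the vector whose $j$-th coordinate is $1$ if $\big(\mathcal A_N^\circ(G_N,\omega)\big)_j\ge U_j$ and $-1$ otherwise. Then $$\mathbb P\big[\mathcal A_N(G_N,\omega,\vec U)\text{ is a solution of the Ising perceptron with } I=[\kappa,\infty)\big]\longrightarrow 0\qquad (N\to\infty).$$ -/

import Mathlib

open MeasureTheory ProbabilityTheory Filter Topology Asymptotics

noncomputable section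

namespace IsingPerceptron

/-- The discrete cube `{-1, 1}^N`. -/
def cube (N : ℕ) : Set (Fin N → ℝ) := {σ | ∀ j, σ j = 1 ∨ σ j = -1}

/-- The law of an `M × N` disorder matrix whose rows are i.i.d. `N(0, I_N)` vectors,
i.e. whose entries are i.i.d. standard Gaussians. -/
def disorderLaw (M N : ℕ) : Measure (Fin M → Fin N → ℝ) :=
  Measure.pi fun _ => Measure.pi fun _ => gaussianReal 0 1

/-- The solutions of the Ising perceptron with disorder `G` and constraint set `I`: the points
`σ ∈ {-1, 1}^N` with `⟨g_i, σ⟩ / √N ∈ I` for every row `g_i` of `G`. -/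
def solutions {M N : ℕ} (G : Fin M → Fin N → ℝ) (I : Set ℝ) : Set (Fin N → ℝ) :=
  {σ | σ ∈ cube N ∧ ∀ i, (∑ j, G i j * σ j) / Real.sqrt N ∈ I}

/-- The law of `N` i.i.d. uniform random variables on `[-1, 1]`. -/
def roundingLaw (N : ℕ) : Measure (Fin N → ℝ) :=
  Measure.pi fun _ => cond volume (Set.Icc (-1 : ℝ) 1)

open Classical in
/-- Coordinatewise rounding of `x` to the cube with thresholds `U`. -/
def round {N : ℕ} (U x : Fin N → ℝ) : Fin N → ℝ := fun j => if U j ≤ x j then 1 else -1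

/-- For each fixed value of the auxiliary randomness `ω`, every output coordinate of `A` is a real
polynomial of total degree at most `D` in the entries of the disorder matrix. -/
def IsPolynomialOfDegree {M N : ℕ} {Ω : Type*} (D : ℕ)
    (A : (Fin M → Fin N → ℝ) → Ω → Fin N → ℝ) : Prop :=
  ∀ ω j, ∃ p : MvPolynomial (Fin M × Fin N) ℝ, p.totalDegree ≤ D ∧
    ∀ G, A G ω j = MvPolynomial.eval (fun e => G e.1 e.2) p

/-- `𝔼 ‖A(G, ω)‖²` (Euclidean norm), with `G` and `ω` independent and `ω ∼ P`. -/
def secondMoment {M N : ℕ} {Ω : Type*} [MeasurableSpace Ω] (P : Measure Ω)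
    (A : (Fin M → Fin N → ℝ) → Ω → Fin N → ℝ) : ENNReal :=
  ∫⁻ z, ENNReal.ofReal (∑ j, A z.1 z.2 j ^ 2) ∂((disorderLaw M N).prod P)

/-- The probability that the randomized rounding of `A` solves the Ising perceptron with constraint
set `I`; the disorder `G`, the auxiliary randomness `ω ∼ P` and the rounding thresholds `U` are
independent. -/
def successProb {M N : ℕ} {Ω : Type*} [MeasurableSpace Ω] (P : Measure Ω)
    (A : (Fin M → Fin N → ℝ) → Ω → Fin N → ℝ) (I : Set ℝ) : ENNReal :=
  ((disorderLaw M N).prod (P.prod (roundingLaw N)))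
    {z | round z.2.2 (A z.1 z.2.1) ∈ solutions z.1 I}

end IsingPerceptron

end

/-!
Two correlated copies of the disorder are joined by an Ornstein–Uhlenbeck path. A polynomial of low
degree is noise stable, so a successful algorithm outputs, on two consecutive disorders of the path,
solutions that are close with probability bounded below; by reversibility and Jensen's inequality it
then does so along the whole path with probability at least exponentially small in its length, which
is `o(N)`. On that event the outputs move slowly while the disorders decorrelate, so that one finds
`n + 1` solutions at pairwise decorrelated times, each close to an earlier one. The number of such
clusters has small entropy, whereas by the Bonferroni inequality a single row has probability at
least about `(n + 1) ℙ[g < κ] / 2` of violating one of the `n + 1` constraints. At the densities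
considered the union bound over clusters beats the lower bound.
-/

noncomputable section

namespace IsingPerceptron

/-! ### The stationary Ornstein–Uhlenbeck chain -/

/-- A measure `γ` for which `γ ⊗ γ` is invariant under every reflection mixing the two factors, as
it is for a centered Gaussian. Asking for reflections rather than rotations makes the exchange of
the two ends of an Ornstein–Uhlenbeck step one of these symmetries. -/
def ReflectionInvariant {E : Type*} [AddCommGroup E] [Module ℝ E] [MeasurableSpace E]
    (γ : Measure E) : Prop :=
  ∀ c s : ℝ, c ^ 2 + s ^ 2 = 1 →
    MeasurePreserving (fun p : E × E => (c • p.1 + s • p.2, s • p.1 - c • p.2))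
      (γ.prod γ) (γ.prod γ)

theorem reflectionInvariant_gaussianReal (v : NNReal) :
    ReflectionInvariant (gaussianReal 0 v) := by
  intro c s hcs
  obtain ⟨θ, rfl, rfl⟩ : ∃ θ, c = Real.cos θ ∧ s = Real.sin θ := by
    have hnorm : ‖(⟨c, s⟩ : ℂ)‖ = 1 := by
      rw [Complex.norm_def, Complex.normSq_mk, Real.sqrt_eq_one, ← sq, ← sq, hcs]
    have hne : (⟨c, s⟩ : ℂ) ≠ 0 := norm_ne_zero_iff.mp (hnorm ▸ one_ne_zero)
    exact ⟨Complex.arg ⟨c, s⟩, by rw [Complex.cos_arg hne, hnorm, div_one],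
      by rw [Complex.sin_arg, hnorm, div_one]⟩
  have hrot : MeasurePreserving (ContinuousLinearMap.rotation θ : ℝ × ℝ → ℝ × ℝ)
      ((gaussianReal 0 v).prod (gaussianReal 0 v)) ((gaussianReal 0 v).prod (gaussianReal 0 v)) :=
    ⟨(ContinuousLinearMap.rotation θ).continuous.measurable,
      IsGaussian.map_rotation_eq_self (by simp) θ⟩
  have hneg : MeasurePreserving (fun x : ℝ => -x) (gaussianReal 0 v) (gaussianReal 0 v) :=
    ⟨measurable_neg, by rw [gaussianReal_map_neg, neg_zero]⟩
  convert ((MeasurePreserving.id (gaussianReal 0 v)).prod hneg).comp hrot using 1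
  ext p
  · simp [ContinuousLinearMap.rotation_apply]
  · simp [ContinuousLinearMap.rotation_apply]; ring

theorem ReflectionInvariant.pi {ι E : Type*} [Fintype ι] [AddCommGroup E] [Module ℝ E]
    [MeasurableSpace E] {γ : Measure E} [SigmaFinite γ] (hγ : ReflectionInvariant γ) :
    ReflectionInvariant (Measure.pi fun _ : ι => γ) := by
  intro c s hcs
  have hsplit := measurePreserving_arrowProdEquivProdArrow E E ι (fun _ => γ) (fun _ => γ)
  exact (hsplit.comp (measurePreserving_pi _ _ fun _ => hγ c s hcs)).comp (hsplit.symm _)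

theorem sq_add_sqrt_one_sub_sq_sq {ρ : ℝ} (hρ : |ρ| ≤ 1) : ρ ^ 2 + √(1 - ρ ^ 2) ^ 2 = 1 := by
  rw [Real.sq_sqrt (sub_nonneg.mpr ((sq_le_one_iff_abs_le_one ρ).mpr hρ)), add_sub_cancel]

section Step

variable {E : Type*} [AddCommGroup E] [Module ℝ E]

/-- The Ornstein–Uhlenbeck step of correlation `ρ` from `x` with innovation `z`. -/
def ouStep (ρ : ℝ) (x z : E) : E :=
  ρ • x + √(1 - ρ ^ 2) • z

theorem ouStep_involutive {ρ : ℝ} (hρ : |ρ| ≤ 1) (x z : E) :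
    ouStep ρ (ouStep ρ x z) (√(1 - ρ ^ 2) • x - ρ • z) = x := by
  calc _ = (ρ ^ 2 + √(1 - ρ ^ 2) ^ 2) • x := by unfold ouStep; module
    _ = x := by rw [sq_add_sqrt_one_sub_sq_sq hρ, one_smul]

variable [MeasurableSpace E]

/-- The joint law of two consecutive states of the Ornstein–Uhlenbeck chain started from `γ`. -/
def ouPair (γ : Measure E) (ρ : ℝ) : Measure (E × E) :=
  (γ.prod γ).map fun p => (p.1, ouStep ρ p.1 p.2)

/-- The transition operator of the Ornstein–Uhlenbeck chain, with each transition `x → y` weighted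
by `k x y`. -/
def ouTransition (γ : Measure E) (ρ : ℝ) (k : E → E → ENNReal) (f : E → ENNReal) (x : E) :
    ENNReal :=
  ∫⁻ z, k x (ouStep ρ x z) * f (ouStep ρ x z) ∂γ

theorem ReflectionInvariant.lintegral_lintegral_add_smul [MeasurableConstSMul ℝ E]
    {γ : Measure E} [IsProbabilityMeasure γ] (hγ : ReflectionInvariant γ) (c s : ℝ)
    {F : E → ENNReal} (hF : Measurable F) :
    ∫⁻ z₁, ∫⁻ z₂, F (c • z₁ + s • z₂) ∂γ ∂γ = ∫⁻ z, F (√(c ^ 2 + s ^ 2) • z) ∂γ := by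
  set r := √(c ^ 2 + s ^ 2) with hr
  have hr_sq : r ^ 2 = c ^ 2 + s ^ 2 := Real.sq_sqrt (by positivity)
  rcases eq_or_ne r 0 with hr0 | hr0
  · obtain ⟨rfl, rfl⟩ : c = 0 ∧ s = 0 := by
      rw [hr0] at hr_sq
      constructor <;> nlinarith [sq_nonneg c, sq_nonneg s]
    simp [hr0]
  have hunit : (c / r) ^ 2 + (s / r) ^ 2 = 1 := by
    rw [div_pow, div_pow, ← add_div, ← hr_sq, div_self (pow_ne_zero 2 hr0)]
  have hmix := measurePreserving_fst.comp (hγ _ _ hunit)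
  have hFr : Measurable fun z => F (r • z) := hF.comp (measurable_id.const_smul r)
  rw [← hmix.lintegral_comp hFr, lintegral_prod (fun p => F (r • _))
    (hFr.comp hmix.measurable).aemeasurable]
  simp only [Function.comp_apply, smul_add, smul_smul, mul_div_cancel₀ _ hr0]

variable [MeasurableAdd₂ E] [MeasurableConstSMul ℝ E]

theorem measurable_ouStep (ρ : ℝ) : Measurable fun p : E × E => ouStep ρ p.1 p.2 :=
  (measurable_fst.const_smul ρ).add (measurable_snd.const_smul _)

theorem measurable_ouStep_left (ρ : ℝ) (x : E) : Measurable (ouStep ρ x) :=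
  (measurable_ouStep ρ).comp measurable_prodMk_left

theorem measurable_prodMk_ouStep (ρ : ℝ) :
    Measurable fun p : E × E => (p.1, ouStep ρ p.1 p.2) :=
  measurable_fst.prodMk (measurable_ouStep ρ)

variable {γ : Measure E}

theorem measurePreserving_ouPair (ρ : ℝ) :
    MeasurePreserving (fun p : E × E => (p.1, ouStep ρ p.1 p.2)) (γ.prod γ) (ouPair γ ρ) :=
  ⟨measurable_prodMk_ouStep ρ, rfl⟩

theorem ReflectionInvariant.measurePreserving_swap_ouPair (hγ : ReflectionInvariant γ) {ρ : ℝ}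
    (hρ : |ρ| ≤ 1) : MeasurePreserving Prod.swap (ouPair γ ρ) (ouPair γ ρ) := by
  have hreflect := hγ _ _ (sq_add_sqrt_one_sub_sq_sq hρ)
  refine ⟨measurable_swap, ?_⟩
  rw [ouPair, Measure.map_map measurable_swap (measurable_prodMk_ouStep ρ)]
  conv_rhs => rw [← hreflect.map_eq,
    Measure.map_map (measurable_prodMk_ouStep ρ) hreflect.measurable]
  congr 1
  ext1 p
  exact Prod.ext rfl (ouStep_involutive hρ p.1 p.2).symm

variable [IsProbabilityMeasure γ]

instance (ρ : ℝ) : IsProbabilityMeasure (ouPair γ ρ) :=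
  Measure.isProbabilityMeasure_map (measurable_prodMk_ouStep ρ).aemeasurable

theorem lintegral_ouPair (ρ : ℝ) {F : E × E → ENNReal} (hF : Measurable F) :
    ∫⁻ q, F q ∂ouPair γ ρ = ∫⁻ x, ∫⁻ z, F (x, ouStep ρ x z) ∂γ ∂γ := by
  rw [← (measurePreserving_ouPair ρ).lintegral_comp hF]
  exact lintegral_prod _ (hF.comp (measurable_prodMk_ouStep ρ)).aemeasurable

theorem measurePreserving_fst_ouPair (ρ : ℝ) : MeasurePreserving Prod.fst (ouPair γ ρ) γ :=
  ⟨measurable_fst, by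
    rw [ouPair, Measure.map_map measurable_fst (measurable_prodMk_ouStep ρ)]
    exact measurePreserving_fst.map_eq⟩

theorem ReflectionInvariant.measurePreserving_snd_ouPair (hγ : ReflectionInvariant γ) {ρ : ℝ}
    (hρ : |ρ| ≤ 1) : MeasurePreserving Prod.snd (ouPair γ ρ) γ :=
  (measurePreserving_fst_ouPair ρ).comp (hγ.measurePreserving_swap_ouPair hρ)

theorem measurable_ouTransition {ρ : ℝ} {k : E → E → ENNReal}
    (hk : Measurable (Function.uncurry k)) {f : E → ENNReal} (hf : Measurable f) :
    Measurable (ouTransition γ ρ k f) :=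
  Measurable.lintegral_prod_right'
    (f := fun p : E × E => k p.1 (ouStep ρ p.1 p.2) * f (ouStep ρ p.1 p.2))
    ((hk.comp (measurable_prodMk_ouStep ρ)).mul (hf.comp (measurable_ouStep ρ)))

theorem lintegral_mul_ouTransition {ρ : ℝ} {k : E → E → ENNReal}
    (hk : Measurable (Function.uncurry k)) {f g : E → ENNReal} (hf : Measurable f)
    (hg : Measurable g) :
    ∫⁻ x, f x * ouTransition γ ρ k g x ∂γ =
      ∫⁻ q, f q.1 * (k q.1 q.2 * g q.2) ∂ouPair γ ρ := by
  rw [lintegral_ouPair ρ (F := fun q => f q.1 * (k q.1 q.2 * g q.2))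
    ((hf.comp measurable_fst).mul (hk.mul (hg.comp measurable_snd)))]
  refine lintegral_congr fun x => (lintegral_const_mul _ ?_).symm
  exact (hk.comp (measurable_prodMk_left.comp (measurable_ouStep_left ρ x))).mul
    (hg.comp (measurable_ouStep_left ρ x))

theorem ReflectionInvariant.lintegral_mul_ouTransition_comm (hγ : ReflectionInvariant γ) {ρ : ℝ}
    (hρ : |ρ| ≤ 1) {k : E → E → ENNReal} (hk : Measurable (Function.uncurry k))
    (hsymm : ∀ x y, k x y = k y x) {f g : E → ENNReal} (hf : Measurable f) (hg : Measurable g) :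
    ∫⁻ x, f x * ouTransition γ ρ k g x ∂γ = ∫⁻ x, ouTransition γ ρ k f x * g x ∂γ := by
  simp_rw [mul_comm _ (g _)]
  rw [lintegral_mul_ouTransition hk hf hg, lintegral_mul_ouTransition hk hg hf,
    ← (hγ.measurePreserving_swap_ouPair hρ).lintegral_comp
      (f := fun q => f q.1 * (k q.1 q.2 * g q.2))
      ((hf.comp measurable_fst).mul (hk.mul (hg.comp measurable_snd)))]
  refine lintegral_congr fun q => ?_
  simp only [Prod.fst_swap, Prod.snd_swap, hsymm q.2 q.1]
  ring

theorem ReflectionInvariant.lintegral_ouStep_ouStep (hγ : ReflectionInvariant γ) {a b : ℝ}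
    (ha : |a| ≤ 1) (hb : |b| ≤ 1) {F : E → ENNReal} (hF : Measurable F) (x : E) :
    ∫⁻ z₁, ∫⁻ z₂, F (ouStep b (ouStep a x z₁) z₂) ∂γ ∂γ = ∫⁻ z, F (ouStep (b * a) x z) ∂γ := by
  have hvar : (b * √(1 - a ^ 2)) ^ 2 + √(1 - b ^ 2) ^ 2 = 1 - (b * a) ^ 2 := by
    linear_combination b ^ 2 * sq_add_sqrt_one_sub_sq_sq ha + sq_add_sqrt_one_sub_sq_sq hb
  have hF' : Measurable fun y => F ((b * a) • x + y) := hF.comp (measurable_const_add _)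
  calc _ = ∫⁻ z₁, ∫⁻ z₂, F ((b * a) • x + ((b * √(1 - a ^ 2)) • z₁ + √(1 - b ^ 2) • z₂)) ∂γ ∂γ := by
        simp only [ouStep, smul_add, smul_smul, add_assoc]
    _ = _ := by
        rw [hγ.lintegral_lintegral_add_smul _ _ hF', hvar]
        rfl

theorem sq_lintegral_le {α : Type*} [MeasurableSpace α] {μ : Measure α} [IsProbabilityMeasure μ]
    {f : α → ENNReal} (hf : Measurable f) : (∫⁻ x, f x ∂μ) ^ 2 ≤ ∫⁻ x, f x ^ 2 ∂μ := by
  have hölder := ENNReal.lintegral_mul_le_Lp_mul_Lq μ Real.HolderConjugate.two_two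
    hf.aemeasurable (g := 1) aemeasurable_const
  simp only [Pi.one_apply, Pi.mul_apply, ENNReal.rpow_two, one_pow, lintegral_one, measure_univ,
    ENNReal.one_rpow, mul_one] at hölder
  calc _ ≤ ((∫⁻ x, f x ^ 2 ∂μ) ^ (1 / 2 : ℝ)) ^ 2 := by gcongr
    _ = _ := by rw [← ENNReal.rpow_natCast, ← ENNReal.rpow_mul]; norm_num

/-- The operator of correlation `√ρ` is symmetric, preserves the mean and squares to the one of
correlation `ρ`. -/
theorem ReflectionInvariant.sq_lintegral_le_lintegral_ouPair (hγ : ReflectionInvariant γ) {ρ : ℝ}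
    (h0 : 0 ≤ ρ) (h1 : ρ ≤ 1) {f : E → ENNReal} (hf : Measurable f) :
    (∫⁻ x, f x ∂γ) ^ 2 ≤ ∫⁻ q, f q.1 * f q.2 ∂ouPair γ ρ := by
  have hroot : |√ρ| ≤ 1 := by
    rw [abs_of_nonneg (Real.sqrt_nonneg ρ)]
    exact Real.sqrt_le_one.mpr h1
  set Q : (E → ENNReal) → E → ENNReal := ouTransition γ √ρ fun _ _ => 1 with hQ
  have hQf : Measurable (Q f) := measurable_ouTransition measurable_const hf
  have hself_adjoint : ∀ g h : E → ENNReal, Measurable g → Measurable h →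
      ∫⁻ x, g x * Q h x ∂γ = ∫⁻ x, Q g x * h x ∂γ := fun g h =>
    hγ.lintegral_mul_ouTransition_comm hroot measurable_const fun _ _ => rfl
  have hmean : ∫⁻ x, Q f x ∂γ = ∫⁻ x, f x ∂γ := by
    simpa [hQ, ouTransition] using hself_adjoint 1 f measurable_one hf
  have hQQ : ∀ x, Q (Q f) x = ouTransition γ ρ (fun _ _ => 1) f x := fun x => by
    simp only [hQ, ouTransition, one_mul]
    rw [hγ.lintegral_ouStep_ouStep hroot hroot hf, Real.mul_self_sqrt h0]
  calc (∫⁻ x, f x ∂γ) ^ 2 = (∫⁻ x, Q f x ∂γ) ^ 2 := by rw [hmean]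
    _ ≤ ∫⁻ x, Q f x ^ 2 ∂γ := sq_lintegral_le hQf
    _ = ∫⁻ x, f x * Q (Q f) x ∂γ := by simp only [hself_adjoint f (Q f) hf hQf, sq]
    _ = ∫⁻ x, f x * ouTransition γ ρ (fun _ _ => 1) f x ∂γ := by simp only [hQQ]
    _ = _ := by 
        simp only [lintegral_mul_ouTransition (k := fun _ _ => 1) measurable_const hf hf, one_mul]

end Step

/-! ### Noise stability of polynomials -/

/-- Finiteness of all absolute moments of `f`. This is the integrability notion that is closed under
products. -/
def HasFiniteMoments {α : Type*} [MeasurableSpace α] (f : α → ℝ) (μ : Measure α) : Prop :=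
  ∀ p : ENNReal, p ≠ ⊤ → MemLp f p μ

namespace HasFiniteMoments

variable {α : Type*} [MeasurableSpace α] {μ : Measure α} {f g : α → ℝ}

theorem integrable (hf : HasFiniteMoments f μ) : Integrable f μ :=
  memLp_one_iff_integrable.mp (hf 1 ENNReal.one_ne_top)

theorem const [IsFiniteMeasure μ] (c : ℝ) : HasFiniteMoments (fun _ => c) μ :=
  fun _ _ => memLp_const c

theorem add (hf : HasFiniteMoments f μ) (hg : HasFiniteMoments g μ) : HasFiniteMoments (f + g) μ :=
  fun p hp => (hf p hp).add (hg p hp)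

theorem const_mul (hf : HasFiniteMoments f μ) (c : ℝ) : HasFiniteMoments (fun x => c * f x) μ :=
  fun p hp => (hf p hp).const_mul c

theorem mul (hf : HasFiniteMoments f μ) (hg : HasFiniteMoments g μ) : HasFiniteMoments (f * g) μ :=
  fun p hp => by
    have h2p : 2 * p ≠ ⊤ := ENNReal.mul_ne_top ENNReal.ofNat_ne_top hp
    have : ENNReal.HolderTriple (2 * p) (2 * p) p :=
      ⟨by rw [ENNReal.mul_inv (by simp) (by simp), ← add_mul, ENNReal.inv_two_add_inv_two, one_mul]⟩
    exact (hg _ h2p).mul (hf _ h2p)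

end HasFiniteMoments

section DegreeLT

variable {E ι : Type*} [AddCommGroup E] [Module ℝ E] (L : ι → E →ₗ[ℝ] ℝ)

/-- The functions that are polynomials of degree less than `k` in the linear functionals `L i`. -/
def degreeLT (k : ℕ) : Submodule ℝ (E → ℝ) :=
  Submodule.span ℝ {f | ∃ l : List ι, l.length < k ∧ f = fun x => (l.map fun i => L i x).prod}

theorem monomial_mem_degreeLT {l : List ι} {k : ℕ} (hl : l.length < k) :
    (fun x => (l.map fun i => L i x).prod) ∈ degreeLT L k :=
  Submodule.subset_span ⟨l, hl, rfl⟩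

theorem degreeLT_mono : Monotone (degreeLT L) := fun _ _ hkl =>
  Submodule.span_mono fun _ ⟨l, hl, hf⟩ => ⟨l, hl.trans_le hkl, hf⟩

theorem degreeLT_zero : degreeLT L 0 = ⊥ := by
  simp [degreeLT]

instance [Finite ι] (k : ℕ) : FiniteDimensional ℝ (degreeLT L k) := by
  refine FiniteDimensional.span_of_finite ℝ ?_
  refine ((List.finite_length_lt ι k).image fun l x => (l.map fun i => L i x).prod).subset ?_
  rintro f ⟨l, hl, rfl⟩
  exact ⟨l, hl, rfl⟩

theorem mul_mem_degreeLT_succ (i : ι) {k : ℕ} {f : E → ℝ} (hf : f ∈ degreeLT L k) :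
    L i * f ∈ degreeLT L (k + 1) := by
  induction hf using Submodule.span_induction with
  | mem f hf =>
    obtain ⟨l, hl, rfl⟩ := hf
    exact Submodule.subset_span ⟨i :: l, by simpa using hl, by ext x; simp⟩
  | zero => simp
  | add f g _ _ hf hg => exact mul_add (L i : E → ℝ) f g ▸ Submodule.add_mem _ hf hg
  | smul c f _ hf => exact mul_smul_comm c (L i : E → ℝ) f ▸ Submodule.smul_mem _ c hf

theorem eval_mem_degreeLT {D : ℕ} {p : MvPolynomial ι ℝ} (hp : p.totalDegree ≤ D) :
    (fun x => MvPolynomial.eval (fun i => L i x) p) ∈ degreeLT L (D + 1) := by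
  classical
  have hsum : (fun x => MvPolynomial.eval (fun i => L i x) p) =
      ∑ d ∈ p.support, p.coeff d • fun x => (d.toMultiset.toList.map fun i => L i x).prod := by
    ext x
    rw [MvPolynomial.eval_eq, Finset.sum_apply]
    refine Finset.sum_congr rfl fun d _ => ?_
    rw [Pi.smul_apply, smul_eq_mul, Multiset.prod_map_toList, Finset.prod_multiset_map_count,
      Finsupp.toFinset_toMultiset]
    simp only [Finsupp.count_toMultiset]
  rw [hsum]
  refine Submodule.sum_mem _ fun d hd => Submodule.smul_mem _ _ (monomial_mem_degreeLT L ?_)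
  rw [Multiset.length_toList, Finsupp.card_toMultiset]
  exact Nat.lt_succ_of_le ((MvPolynomial.le_totalDegree hd).trans hp)

theorem map_ouStep_apply (φ : E →ₗ[ℝ] ℝ) (ρ : ℝ) (x z : E) :
    φ (ouStep ρ x z) = ρ * φ x + √(1 - ρ ^ 2) * φ z := by
  simp [ouStep]

variable {L} [MeasurableSpace E] {γ : Measure E} [IsProbabilityMeasure γ]

theorem hasFiniteMoments_monomial (hL : ∀ i, HasFiniteMoments (L i) γ) (l : List ι) :
    HasFiniteMoments (fun x => (l.map fun i => L i x).prod) γ := by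
  induction l with
  | nil => exact .const 1
  | cons i l ih => simpa using! (hL i).mul ih

theorem hasFiniteMoments_of_mem_degreeLT (hL : ∀ i, HasFiniteMoments (L i) γ) {k : ℕ} {f : E → ℝ}
    (hf : f ∈ degreeLT L k) : HasFiniteMoments f γ := by
  induction hf using Submodule.span_induction with
  | mem f hf =>
    obtain ⟨l, -, rfl⟩ := hf
    exact hasFiniteMoments_monomial hL l
  | zero => exact .const 0
  | add f g _ _ hf hg => exact hf.add hg
  | smul c f _ hf => exact hf.const_mul c

theorem memLp_two_of_mem_degreeLT (hL : ∀ i, HasFiniteMoments (L i) γ) {k : ℕ} {f : E → ℝ}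
    (hf : f ∈ degreeLT L k) : MemLp f 2 γ :=
  hasFiniteMoments_of_mem_degreeLT hL hf 2 ENNReal.ofNat_ne_top

theorem hasFiniteMoments_monomial_ouStep (hL : ∀ i, HasFiniteMoments (L i) γ) (ρ : ℝ) (x : E)
    (l : List ι) : HasFiniteMoments (fun z => (l.map fun i => L i (ouStep ρ x z)).prod) γ := by
  induction l with
  | nil => exact .const 1
  | cons i l ih =>
    have hi : HasFiniteMoments (fun z => L i (ouStep ρ x z)) γ := by
      simp only [map_ouStep_apply]
      exact (HasFiniteMoments.const (ρ * L i x)).add ((hL i).const_mul _)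
    simpa using! hi.mul ih

/-- The weight `w` collects the factors of the innovation that the expansion produces. -/
theorem integral_mul_monomial_ouStep_sub_mem (hL : ∀ i, HasFiniteMoments (L i) γ) (ρ : ℝ)
    (l : List ι) {w : E → ℝ} (hw : HasFiniteMoments w γ) :
    (fun x => ∫ z, w z * (l.map fun i => L i (ouStep ρ x z)).prod ∂γ) -
      (ρ ^ l.length * ∫ z, w z ∂γ) • (fun x => (l.map fun i => L i x).prod) ∈
        degreeLT L l.length := by
  induction l generalizing w with
  | nil =>
    convert Submodule.zero_mem _
    ext x
    simp
  | cons i l ih =>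
    set m : E → ℝ := fun x => (l.map fun i => L i x).prod with hm
    set W : (E → ℝ) → E → ℝ := fun w x => ∫ z, w z * m (ouStep ρ x z) ∂γ with hW
    have hexpand : (fun x => ∫ z, w z * ((i :: l).map fun i => L i (ouStep ρ x z)).prod ∂γ) =
        ρ • (L i * W w) + √(1 - ρ ^ 2) • W (w * L i) := by
      ext x
      have hmx : HasFiniteMoments (fun z => m (ouStep ρ x z)) γ :=
        hasFiniteMoments_monomial_ouStep hL ρ x l
      have hprod_int := ((hw.mul hmx).const_mul (ρ * L i x)).integrable
      have hprod_int' := (((hw.mul (hL i)).mul hmx).const_mul √(1 - ρ ^ 2)).integrable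
      have hsplit : ∀ z, w z * ((i :: l).map fun i => L i (ouStep ρ x z)).prod =
          ρ * L i x * (w z * m (ouStep ρ x z)) +
            √(1 - ρ ^ 2) * (w z * L i z * m (ouStep ρ x z)) := fun z => by
        rw [List.map_cons, List.prod_cons, map_ouStep_apply]
        ring
      simp only [hsplit]
      refine (integral_add hprod_int hprod_int').trans ?_
      rw [integral_const_mul, integral_const_mul, mul_assoc]
      rfl
    have hfirst := Submodule.smul_mem _ ρ (mul_mem_degreeLT_succ L i (ih hw))
    have hsecond : W (w * L i) ∈ degreeLT L (l.length + 1) :=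
      (Submodule.sub_mem_iff_left _
        (Submodule.smul_mem _ _ (monomial_mem_degreeLT L l.length.lt_succ_self))).mp
        (degreeLT_mono L l.length.le_succ (ih (hw.mul (hL i))))
    rw [hexpand, List.length_cons]
    convert Submodule.add_mem _ hfirst (Submodule.smul_mem _ √(1 - ρ ^ 2) hsecond) using 1
    ext x
    simp only [Pi.sub_apply, Pi.add_apply, Pi.smul_apply, Pi.mul_apply, smul_eq_mul, hW, hm,
      List.map_cons, List.prod_cons]
    ring

/-- The Ornstein–Uhlenbeck operator on real functions. -/
def ouAverage (γ : Measure E) (ρ : ℝ) (f : E → ℝ) (x : E) : ℝ := ∫ z, f (ouStep ρ x z) ∂γ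

theorem hasFiniteMoments_comp_ouStep (hL : ∀ i, HasFiniteMoments (L i) γ) (ρ : ℝ) (x : E) {k : ℕ}
    {f : E → ℝ} (hf : f ∈ degreeLT L k) : HasFiniteMoments (fun z => f (ouStep ρ x z)) γ := by
  induction hf using Submodule.span_induction with
  | mem f hf =>
    obtain ⟨l, -, rfl⟩ := hf
    exact hasFiniteMoments_monomial_ouStep hL ρ x l
  | zero => exact .const 0
  | add f g _ _ hf hg => exact hf.add hg
  | smul c f _ hf => exact hf.const_mul c

/-- On polynomials of degree `k`, the Ornstein–Uhlenbeck operator is `ρ ^ k` up to lower order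
terms. -/
theorem ouAverage_sub_mem_degreeLT (hL : ∀ i, HasFiniteMoments (L i) γ) (ρ : ℝ) {k : ℕ}
    {f : E → ℝ} (hf : f ∈ degreeLT L (k + 1)) :
    ouAverage γ ρ f - ρ ^ k • f ∈ degreeLT L k := by
  induction hf using Submodule.span_induction with
  | mem f hf =>
    obtain ⟨l, hl, rfl⟩ := hf
    have hlead := integral_mul_monomial_ouStep_sub_mem hL ρ l (.const 1)
    simp only [one_mul, integral_const, probReal_univ, smul_eq_mul, mul_one] at hlead
    rcases (Nat.lt_succ_iff.mp hl).eq_or_lt with rfl | hl'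
    · exact hlead
    · have hmem := monomial_mem_degreeLT L hl'
      have havg := (Submodule.sub_mem_iff_left _ (Submodule.smul_mem _ (ρ ^ l.length) hmem)).mp
        (degreeLT_mono L hl'.le hlead)
      exact Submodule.sub_mem _ havg (Submodule.smul_mem _ _ hmem)
  | zero =>
    convert Submodule.zero_mem _
    ext x
    simp [ouAverage]
  | add f g hf hg hf' hg' =>
    have hadd : ouAverage γ ρ (f + g) = ouAverage γ ρ f + ouAverage γ ρ g := by
      ext x
      exact integral_add (hasFiniteMoments_comp_ouStep hL ρ x hf).integrable
        (hasFiniteMoments_comp_ouStep hL ρ x hg).integrable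
    rw [hadd, smul_add, add_sub_add_comm]
    exact Submodule.add_mem _ hf' hg'
  | smul c f _ hf' =>
    have hsmul : ouAverage γ ρ (c • f) = c • ouAverage γ ρ f := by
      ext x
      exact integral_const_mul c _
    rw [hsmul, smul_comm, ← smul_sub]
    exact Submodule.smul_mem _ _ hf'

theorem ouAverage_mem_degreeLT (hL : ∀ i, HasFiniteMoments (L i) γ) (ρ : ℝ) {k : ℕ} {f : E → ℝ}
    (hf : f ∈ degreeLT L k) : ouAverage γ ρ f ∈ degreeLT L k :=
  (Submodule.sub_mem_iff_left _ (Submodule.smul_mem _ (ρ ^ k) hf)).mp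
    (ouAverage_sub_mem_degreeLT hL ρ (degreeLT_mono L k.le_succ hf))

end DegreeLT

theorem exists_mem_forall_integral_sub_mul_eq_zero {α : Type*} [MeasurableSpace α] {μ : Measure α}
    (V : Submodule ℝ (α → ℝ)) [FiniteDimensional ℝ V] (hV : ∀ f ∈ V, MemLp f 2 μ)
    {f : α → ℝ} (hf : MemLp f 2 μ) :
    ∃ g ∈ V, ∀ v ∈ V, ∫ x, (f - g) x * v x ∂μ = 0 := by
  let T : V →ₗ[ℝ] Lp ℝ 2 μ :=
    { toFun := fun v => (hV v v.2).toLp _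
      map_add' := fun u v => MemLp.toLp_add (hV u u.2) (hV v v.2)
      map_smul' := fun c v => MemLp.toLp_const_smul c (hV v v.2) }
  obtain ⟨⟨g, hg⟩, hTg⟩ := T.range.starProjection_apply_mem (hf.toLp f)
  refine ⟨g, hg, fun v hv => ?_⟩
  have horth := T.range.starProjection_inner_eq_zero (hf.toLp f) (T ⟨v, hv⟩) ⟨_, rfl⟩
  have hsub : hf.toLp f - T ⟨g, hg⟩ = (hf.sub (hV g hg)).toLp (f - g) :=
    (MemLp.toLp_sub hf (hV g hg)).symm
  rw [← hTg, hsub, L2.inner_def] at horth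
  rw [← horth]
  refine integral_congr_ae ?_
  filter_upwards [(hf.sub (hV g hg)).coeFn_toLp, (hV v hv).coeFn_toLp] with x hfgx hvx
  rw [hfgx, show (T ⟨v, hv⟩ : α → ℝ) x = v x from hvx]
  simp [mul_comm]

theorem integral_add_mul_add {α : Type*} [MeasurableSpace α] {μ : Measure α} {f₁ f₂ g₁ g₂ : α → ℝ}
    (h₁₁ : Integrable (fun x => f₁ x * g₁ x) μ) (h₁₂ : Integrable (fun x => f₁ x * g₂ x) μ)
    (h₂₁ : Integrable (fun x => f₂ x * g₁ x) μ) (h₂₂ : Integrable (fun x => f₂ x * g₂ x) μ) :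
    ∫ x, (f₁ x + f₂ x) * (g₁ x + g₂ x) ∂μ =
      ∫ x, f₁ x * g₁ x ∂μ + ∫ x, f₁ x * g₂ x ∂μ + (∫ x, f₂ x * g₁ x ∂μ + ∫ x, f₂ x * g₂ x ∂μ) := by
  rw [← integral_add h₁₁ h₁₂, ← integral_add h₂₁ h₂₂]
  simp only [add_mul, mul_add, add_add_add_comm _ (f₂ _ * g₁ _)]
  exact integral_add (h₁₁.add h₁₂) (h₂₁.add h₂₂)

section NoiseStability

variable {E : Type*} [AddCommGroup E] [Module ℝ E] [MeasurableSpace E] [MeasurableAdd₂ E]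
  [MeasurableConstSMul ℝ E] {γ : Measure E}

theorem ReflectionInvariant.integral_mul_ouPair_comm (hγ : ReflectionInvariant γ) {ρ : ℝ}
    (hρ : |ρ| ≤ 1) (f g : E → ℝ) :
    ∫ q, f q.1 * g q.2 ∂ouPair γ ρ = ∫ q, g q.1 * f q.2 ∂ouPair γ ρ := by
  rw [← (hγ.measurePreserving_swap_ouPair hρ).integral_comp
    MeasurableEquiv.prodComm.measurableEmbedding]
  simp only [Prod.fst_swap, Prod.snd_swap, mul_comm]

variable [IsProbabilityMeasure γ]

theorem ReflectionInvariant.integrable_mul_ouPair (hγ : ReflectionInvariant γ) {ρ : ℝ}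
    (hρ : |ρ| ≤ 1) {f g : E → ℝ} (hf : MemLp f 2 γ) (hg : MemLp g 2 γ) :
    Integrable (fun q => f q.1 * g q.2) (ouPair γ ρ) :=
  (hf.comp_measurePreserving (measurePreserving_fst_ouPair ρ)).integrable_mul
    (hg.comp_measurePreserving (hγ.measurePreserving_snd_ouPair hρ))

theorem ReflectionInvariant.integral_mul_ouPair (hγ : ReflectionInvariant γ) {ρ : ℝ}
    (hρ : |ρ| ≤ 1) {f g : E → ℝ} (hf : MemLp f 2 γ) (hg : MemLp g 2 γ) :
    ∫ q, f q.1 * g q.2 ∂ouPair γ ρ = ∫ x, f x * ouAverage γ ρ g x ∂γ := by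
  have hprod_int := hγ.integrable_mul_ouPair hρ hf hg
  have hpair := measurePreserving_ouPair (γ := γ) ρ
  rw [← hpair.map_eq, integral_map hpair.aemeasurable
      (hpair.map_eq ▸ hprod_int.aestronglyMeasurable),
    integral_prod (fun p => f p.1 * g (ouStep ρ p.1 p.2))
      (hpair.integrable_comp_of_integrable hprod_int)]
  exact integral_congr_ae (.of_forall fun x => integral_const_mul (f x) fun z => g (ouStep ρ x z))

variable {ι : Type*} {L : ι → E →ₗ[ℝ] ℝ}

section Orthogonal

variable {ρ : ℝ} {k : ℕ} {g h : E → ℝ}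

theorem ReflectionInvariant.integral_mul_ouPair_of_orthogonal (hγ : ReflectionInvariant γ)
    (hL : ∀ i, HasFiniteMoments (L i) γ) (hρ : |ρ| ≤ 1) (hh : h ∈ degreeLT L (k + 1))
    (horth : ∀ v ∈ degreeLT L k, ∫ x, h x * v x ∂γ = 0) (hg : g ∈ degreeLT L k) :
    ∫ q, h q.1 * g q.2 ∂ouPair γ ρ = 0 := by
  rw [hγ.integral_mul_ouPair hρ (memLp_two_of_mem_degreeLT hL hh)
    (memLp_two_of_mem_degreeLT hL hg)]
  exact horth _ (ouAverage_mem_degreeLT hL ρ hg)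

theorem ReflectionInvariant.integral_mul_self_ouPair_of_orthogonal (hγ : ReflectionInvariant γ)
    (hL : ∀ i, HasFiniteMoments (L i) γ) (hρ : |ρ| ≤ 1) (hh : h ∈ degreeLT L (k + 1))
    (horth : ∀ v ∈ degreeLT L k, ∫ x, h x * v x ∂γ = 0) :
    ∫ q, h q.1 * h q.2 ∂ouPair γ ρ = ρ ^ k * ∫ x, h x * h x ∂γ := by
  have hlower := ouAverage_sub_mem_degreeLT hL ρ hh
  have hh2 := memLp_two_of_mem_degreeLT hL hh
  have hsplit : ∀ x, h x * ouAverage γ ρ h x =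
      h x * (ouAverage γ ρ h - ρ ^ k • h) x + ρ ^ k * (h x * h x) := fun x => by
    simp only [Pi.sub_apply, Pi.smul_apply, smul_eq_mul]
    ring
  simp only [hγ.integral_mul_ouPair hρ hh2 hh2, hsplit]
  have hprod_int : Integrable (fun x => h x * (ouAverage γ ρ h - ρ ^ k • h) x) γ :=
    hh2.integrable_mul (memLp_two_of_mem_degreeLT hL hlower)
  have hprod_int' : Integrable (fun x => ρ ^ k * (h x * h x)) γ :=
    (hh2.integrable_mul hh2).const_mul _
  rw [integral_add hprod_int hprod_int', horth _ hlower, zero_add, integral_const_mul]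

end Orthogonal

theorem ReflectionInvariant.pow_mul_integral_mul_self_le (hγ : ReflectionInvariant γ) [Finite ι]
    (hL : ∀ i, HasFiniteMoments (L i) γ) {ρ : ℝ} (h0 : 0 ≤ ρ) (h1 : ρ ≤ 1) {k : ℕ} {f : E → ℝ}
    (hf : f ∈ degreeLT L k) :
    ρ ^ k * ∫ x, f x * f x ∂γ ≤ ∫ q, f q.1 * f q.2 ∂ouPair γ ρ := by
  have hρ : |ρ| ≤ 1 := by rwa [abs_of_nonneg h0]
  induction k generalizing f with
  | zero =>
    rw [degreeLT_zero, Submodule.mem_bot] at hf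
    simp [hf]
  | succ k ih =>
    obtain ⟨g, hg, horth⟩ := exists_mem_forall_integral_sub_mul_eq_zero (degreeLT L k)
      (fun _ => memLp_two_of_mem_degreeLT hL) (memLp_two_of_mem_degreeLT hL hf)
    have hh : f - g ∈ degreeLT L (k + 1) :=
      Submodule.sub_mem _ hf (degreeLT_mono L k.le_succ hg)
    obtain ⟨h, rfl⟩ : ∃ h, f = g + h := ⟨f - g, by abel⟩
    rw [add_sub_cancel_left] at horth hh
    have hg2 := memLp_two_of_mem_degreeLT hL hg
    have hh2 := memLp_two_of_mem_degreeLT hL hh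
    have hI {u v : E → ℝ} (hu : MemLp u 2 γ) (hv : MemLp v 2 γ) :=
      hγ.integrable_mul_ouPair hρ hu hv
    have hpyth : ∫ x, (g + h) x * (g + h) x ∂γ = ∫ x, g x * g x ∂γ + ∫ x, h x * h x ∂γ := by
      refine (integral_add_mul_add (hg2.integrable_mul hg2) (hg2.integrable_mul hh2)
        (hh2.integrable_mul hg2) (hh2.integrable_mul hh2)).trans ?_
      simp only [mul_comm (g _) (h _), horth g hg, add_zero, zero_add]
    have hpair : ∫ q, (g + h) q.1 * (g + h) q.2 ∂ouPair γ ρ =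
        ∫ q, g q.1 * g q.2 ∂ouPair γ ρ + ρ ^ k * ∫ x, h x * h x ∂γ := by
      refine (integral_add_mul_add (hI hg2 hg2) (hI hg2 hh2) (hI hh2 hg2) (hI hh2 hh2)).trans ?_
      rw [hγ.integral_mul_ouPair_comm hρ g h,
        hγ.integral_mul_ouPair_of_orthogonal hL hρ hh horth hg,
        hγ.integral_mul_self_ouPair_of_orthogonal hL hρ hh horth, add_zero, zero_add]
    have hpow : ρ ^ (k + 1) ≤ ρ ^ k := pow_le_pow_of_le_one h0 h1 k.le_succ
    have hg0 : 0 ≤ ∫ x, g x * g x ∂γ := integral_nonneg fun x => mul_self_nonneg _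
    have hh0 : 0 ≤ ∫ x, h x * h x ∂γ := integral_nonneg fun x => mul_self_nonneg _
    calc _ ≤ ρ ^ k * (∫ x, g x * g x ∂γ + ∫ x, h x * h x ∂γ) := by rw [hpyth]; gcongr
      _ ≤ _ := by rw [hpair, mul_add]; gcongr; exact ih hg

theorem ReflectionInvariant.integral_sub_sq_ouPair (hγ : ReflectionInvariant γ) {ρ : ℝ}
    (hρ : |ρ| ≤ 1) {f : E → ℝ} (hf : MemLp f 2 γ) :
    ∫ q, (f q.1 - f q.2) ^ 2 ∂ouPair γ ρ =
      2 * (∫ x, f x * f x ∂γ - ∫ q, f q.1 * f q.2 ∂ouPair γ ρ) := by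
  have hfst := measurePreserving_fst_ouPair (γ := γ) ρ
  have hsnd := hγ.measurePreserving_snd_ouPair hρ
  have hff := (hf.integrable_mul hf).aestronglyMeasurable
  have hfst_sq : ∫ q, f q.1 * f q.1 ∂ouPair γ ρ = ∫ x, f x * f x ∂γ := by
    conv_rhs => rw [← hfst.map_eq]
    exact (integral_map hfst.aemeasurable (hfst.map_eq.symm ▸ hff)).symm
  have hsnd_sq : ∫ q, f q.2 * f q.2 ∂ouPair γ ρ = ∫ x, f x * f x ∂γ := by
    conv_rhs => rw [← hsnd.map_eq]
    exact (integral_map hsnd.aemeasurable (hsnd.map_eq.symm ▸ hff)).symm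
  have hprod_int := hγ.integrable_mul_ouPair hρ hf hf
  have hint_fst : Integrable (fun q => f q.1 * f q.1) (ouPair γ ρ) :=
    hfst.integrable_comp_of_integrable (hf.integrable_mul hf)
  have hint_snd : Integrable (fun q => f q.2 * f q.2) (ouPair γ ρ) :=
    hsnd.integrable_comp_of_integrable (hf.integrable_mul hf)
  calc ∫ q, (f q.1 - f q.2) ^ 2 ∂ouPair γ ρ =
        ∫ q, f q.1 * f q.1 + f q.2 * f q.2 - 2 * (f q.1 * f q.2) ∂ouPair γ ρ := by
        congr 1 with q
        ring
    _ = ∫ q, f q.1 * f q.1 ∂ouPair γ ρ + ∫ q, f q.2 * f q.2 ∂ouPair γ ρ -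
        2 * ∫ q, f q.1 * f q.2 ∂ouPair γ ρ := by
        rw [← integral_const_mul, ← integral_add hint_fst hint_snd]
        exact integral_sub (hint_fst.add hint_snd) (hprod_int.const_mul 2)
    _ = _ := by rw [hfst_sq, hsnd_sq]; ring

theorem ReflectionInvariant.lintegral_sub_sq_ouPair_le (hγ : ReflectionInvariant γ) [Finite ι]
    (hL : ∀ i, HasFiniteMoments (L i) γ) {ρ : ℝ} (h0 : 0 ≤ ρ) (h1 : ρ ≤ 1) {k : ℕ} {f : E → ℝ}
    (hf : f ∈ degreeLT L k) :
    ∫⁻ q, ENNReal.ofReal ((f q.1 - f q.2) ^ 2) ∂ouPair γ ρ ≤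
      ENNReal.ofReal (2 * (1 - ρ ^ k)) * ∫⁻ x, ENNReal.ofReal (f x ^ 2) ∂γ := by
  have hρ : |ρ| ≤ 1 := by rwa [abs_of_nonneg h0]
  have hf2 := memLp_two_of_mem_degreeLT hL hf
  have hdiff : MemLp (fun q => f q.1 - f q.2) 2 (ouPair γ ρ) :=
    (hf2.comp_measurePreserving (measurePreserving_fst_ouPair ρ)).sub
      (hf2.comp_measurePreserving (hγ.measurePreserving_snd_ouPair hρ))
  have hpow : ρ ^ k ≤ 1 := pow_le_one₀ h0 h1
  rw [← ofReal_integral_eq_lintegral_ofReal hf2.integrable_sq (ae_of_all _ fun x => sq_nonneg _),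
    ← ofReal_integral_eq_lintegral_ofReal hdiff.integrable_sq (ae_of_all _ fun x => sq_nonneg _),
    ← ENNReal.ofReal_mul (by linarith)]
  refine ENNReal.ofReal_le_ofReal ((hγ.integral_sub_sq_ouPair hρ hf2).trans_le ?_)
  simp only [sq (f _)]
  linarith [hγ.pow_mul_integral_mul_self_le hL h0 h1 hf]

end NoiseStability

/-! ### The law of the Ornstein–Uhlenbeck path -/

theorem measurable_const_path {E : Type*} [MeasurableSpace E] :
    Measurable fun (x : E) (_ : ℕ) => x :=
  measurable_pi_lambda _ fun _ => measurable_id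

theorem measurableSet_forall_consecutive {E : Type*} [MeasurableSpace E] {S : Set (E × E)}
    (hS : MeasurableSet S) (T : ℕ) :
    MeasurableSet {w : ℕ → E | ∀ t < T, (w t, w (t + 1)) ∈ S} := by
  simp only [Set.ofPred_forall]
  exact .iInter fun t => .iInter fun _ =>
    ((measurable_pi_apply t).prodMk (measurable_pi_apply (t + 1))) hS

section PathLaw

variable {E : Type*} [AddCommGroup E] [Module ℝ E]

/-- Extend a path known up to time `T` by one Ornstein–Uhlenbeck step, after which it is frozen. -/
def pathStep (ρ : ℝ) (T : ℕ) (p : (ℕ → E) × E) : ℕ → E :=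
  fun t => if t ≤ T then p.1 t else ouStep ρ (p.1 T) p.2

theorem pathStep_of_le {ρ : ℝ} {T t : ℕ} (htT : t ≤ T) (p : (ℕ → E) × E) :
    pathStep ρ T p t = p.1 t := if_pos htT

theorem pathStep_succ {ρ : ℝ} {T : ℕ} (p : (ℕ → E) × E) :
    pathStep ρ T p (T + 1) = ouStep ρ (p.1 T) p.2 := if_neg (by omega)

variable [MeasurableSpace E]

/-- The law of the stationary Ornstein–Uhlenbeck chain run up to time `T` and then frozen. -/
def pathLaw (γ : Measure E) (ρ : ℝ) : ℕ → Measure (ℕ → E)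
  | 0 => γ.map fun x _ => x
  | T + 1 => ((pathLaw γ ρ T).prod γ).map (pathStep ρ T)

variable [MeasurableAdd₂ E] [MeasurableConstSMul ℝ E]

theorem measurable_pathStep (ρ : ℝ) (T : ℕ) :
    Measurable (pathStep ρ T : (ℕ → E) × E → ℕ → E) := by
  refine measurable_pi_lambda _ fun t => ?_
  by_cases htT : t ≤ T
  · simp only [pathStep_of_le htT]
    exact (measurable_pi_apply t).comp measurable_fst
  · simp only [pathStep, if_neg htT]
    exact (measurable_ouStep ρ).comp
      (((measurable_pi_apply T).comp measurable_fst).prodMk measurable_snd)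

variable {γ : Measure E}

theorem measurePreserving_pathStep (ρ : ℝ) (T : ℕ) :
    MeasurePreserving (pathStep ρ T) ((pathLaw γ ρ T).prod γ) (pathLaw γ ρ (T + 1)) :=
  ⟨measurable_pathStep ρ T, rfl⟩

variable [IsProbabilityMeasure γ]

instance (ρ : ℝ) (T : ℕ) : IsProbabilityMeasure (pathLaw γ ρ T) := by
  induction T with
  | zero => exact Measure.isProbabilityMeasure_map measurable_const_path.aemeasurable
  | succ T ih => exact Measure.isProbabilityMeasure_map (measurable_pathStep ρ T).aemeasurable

theorem lintegral_pathLaw_succ (ρ : ℝ) (T : ℕ) {F : (ℕ → E) → ENNReal} (hF : Measurable F) :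
    ∫⁻ w, F w ∂pathLaw γ ρ (T + 1) =
      ∫⁻ w, ∫⁻ z, F (pathStep ρ T (w, z)) ∂γ ∂pathLaw γ ρ T := by
  rw [← (measurePreserving_pathStep ρ T).lintegral_comp hF]
  exact lintegral_prod _ (hF.comp (measurable_pathStep ρ T)).aemeasurable

theorem ReflectionInvariant.measurePreserving_eval_pathLaw (hγ : ReflectionInvariant γ) {ρ : ℝ}
    (hρ : |ρ| ≤ 1) {t T : ℕ} (htT : t ≤ T) :
    MeasurePreserving (fun w : ℕ → E => w t) (pathLaw γ ρ T) γ := by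
  refine ⟨measurable_pi_apply t, ?_⟩
  induction T generalizing t with
  | zero =>
    rw [pathLaw, Measure.map_map (measurable_pi_apply t) measurable_const_path]
    exact Measure.map_id
  | succ T ih =>
    rw [pathLaw, Measure.map_map (measurable_pi_apply t) (measurable_pathStep ρ T)]
    have hprev {s : ℕ} (hs : s ≤ T) : MeasurePreserving (fun w : ℕ → E => w s) (pathLaw γ ρ T) γ :=
      ⟨measurable_pi_apply s, ih hs⟩
    rcases Nat.le_succ_iff.mp htT with htT | rfl
    · rw [show (fun w : ℕ → E => w t) ∘ pathStep ρ T = (fun w => w t) ∘ Prod.fst from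
        funext (pathStep_of_le htT)]
      exact ((hprev htT).comp measurePreserving_fst).map_eq
    · rw [show (fun w : ℕ → E => w (T + 1)) ∘ pathStep ρ T =
          Prod.snd ∘ (fun p : E × E => (p.1, ouStep ρ p.1 p.2)) ∘ Prod.map (fun w => w T) id from
        funext pathStep_succ]
      exact ((hγ.measurePreserving_snd_ouPair hρ).comp ((measurePreserving_ouPair ρ).comp
        ((hprev le_rfl).prod (MeasurePreserving.id γ)))).map_eq

section Weighted

variable {ρ : ℝ} {k : E → E → ENNReal}

theorem measurable_iterate_ouTransition (hk : Measurable (Function.uncurry k)) (n : ℕ)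
    {f : E → ENNReal} (hf : Measurable f) : Measurable ((ouTransition γ ρ k)^[n] f) := by
  induction n generalizing f with
  | zero => exact hf
  | succ _ ih => exact ih (measurable_ouTransition hk hf)

theorem lintegral_pathLaw_prod_mul (hk : Measurable (Function.uncurry k)) (T : ℕ)
    {f : E → ENNReal} (hf : Measurable f) :
    ∫⁻ w, (∏ t ∈ Finset.range T, k (w t) (w (t + 1))) * f (w T) ∂pathLaw γ ρ T =
      ∫⁻ x, (ouTransition γ ρ k)^[T] f x ∂γ := by
  induction T generalizing f with
  | zero =>
    simp only [Finset.range_zero, Finset.prod_empty, one_mul, pathLaw, Function.iterate_zero, id]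
    exact lintegral_map (hf.comp (measurable_pi_apply 0)) measurable_const_path
  | succ T ih =>
    have hweight : Measurable fun w : ℕ → E => ∏ t ∈ Finset.range (T + 1), k (w t) (w (t + 1)) :=
      Finset.measurable_prod _ fun t _ =>
        show Measurable fun w : ℕ → E => Function.uncurry k (w t, w (t + 1)) from
          hk.comp ((measurable_pi_apply t).prodMk (measurable_pi_apply (t + 1)))
    have hF : Measurable fun w : ℕ → E =>
        (∏ t ∈ Finset.range (T + 1), k (w t) (w (t + 1))) * f (w (T + 1)) :=
      hweight.mul (hf.comp (measurable_pi_apply (T + 1)))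
    rw [lintegral_pathLaw_succ ρ T hF,
      Function.iterate_succ_apply, ← ih (measurable_ouTransition hk hf)]
    refine lintegral_congr fun w => ?_
    have hprefix (z : E) :
        ∏ t ∈ Finset.range T, k (pathStep ρ T (w, z) t) (pathStep ρ T (w, z) (t + 1)) =
          ∏ t ∈ Finset.range T, k (w t) (w (t + 1)) :=
      Finset.prod_congr rfl fun t ht => by
        have htT := Finset.mem_range.mp ht
        rw [pathStep_of_le htT.le, pathStep_of_le htT]
    simp only [Finset.prod_range_succ, hprefix, pathStep_succ, pathStep_of_le le_rfl, mul_assoc]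
    exact lintegral_const_mul _
      ((hk.comp (measurable_prodMk_left.comp (measurable_ouStep_left ρ (w T)))).mul
        (hf.comp (measurable_ouStep_left ρ (w T))))

theorem ReflectionInvariant.lintegral_mul_iterate_ouTransition_comm (hγ : ReflectionInvariant γ)
    (hρ : |ρ| ≤ 1) (hk : Measurable (Function.uncurry k)) (hsymm : ∀ x y, k x y = k y x) (n : ℕ)
    {f g : E → ENNReal} (hf : Measurable f) (hg : Measurable g) :
    ∫⁻ x, f x * (ouTransition γ ρ k)^[n] g x ∂γ =
      ∫⁻ x, (ouTransition γ ρ k)^[n] f x * g x ∂γ := by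
  induction n generalizing f g with
  | zero => rfl
  | succ n ih =>
    rw [Function.iterate_succ_apply, Function.iterate_succ_apply',
      ih hf (measurable_ouTransition hk hg)]
    exact hγ.lintegral_mul_ouTransition_comm hρ hk hsymm
      (measurable_iterate_ouTransition hk n hf) hg

theorem ReflectionInvariant.pow_le_lintegral_iterate_ouTransition (hγ : ReflectionInvariant γ)
    (hρ : |ρ| ≤ 1) (hk : Measurable (Function.uncurry k)) (hsymm : ∀ x y, k x y = k y x) (n : ℕ) :
    (∫⁻ x, ouTransition γ ρ k 1 x ∂γ) ^ 2 ^ n ≤ ∫⁻ x, (ouTransition γ ρ k)^[2 ^ n] 1 x ∂γ := by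
  induction n with
  | zero => simp
  | succ n ih =>
    set Q := (ouTransition γ ρ k)^[2 ^ n]
    have hQ1 : Measurable (Q 1) := measurable_iterate_ouTransition hk _ measurable_one
    have hQQ : Q (Q 1) = (ouTransition γ ρ k)^[2 ^ (n + 1)] 1 := by
      rw [pow_succ, mul_two]
      exact (Function.iterate_add_apply _ _ _ _).symm
    calc _ = ((∫⁻ x, ouTransition γ ρ k 1 x ∂γ) ^ 2 ^ n) ^ 2 := by rw [← pow_mul, pow_succ]
      _ ≤ (∫⁻ x, Q 1 x ∂γ) ^ 2 := by gcongr
      _ ≤ ∫⁻ x, Q 1 x ^ 2 ∂γ := sq_lintegral_le hQ1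
      _ = ∫⁻ x, (1 : E → ENNReal) x * Q (Q 1) x ∂γ := by
        simp only [sq]
        exact (hγ.lintegral_mul_iterate_ouTransition_comm hρ hk hsymm _ measurable_one hQ1).symm
      _ = _ := by simp only [hQQ, Pi.one_apply, one_mul]

end Weighted

theorem ReflectionInvariant.ouPair_pow_le_pathLaw (hγ : ReflectionInvariant γ) {ρ : ℝ}
    (hρ : |ρ| ≤ 1) {S : Set (E × E)} (hS : MeasurableSet S)
    (hsymm : ∀ x y, (x, y) ∈ S → (y, x) ∈ S) (n : ℕ) :
    ouPair γ ρ S ^ 2 ^ n ≤ pathLaw γ ρ (2 ^ n) {w | ∀ t < 2 ^ n, (w t, w (t + 1)) ∈ S} := by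
  classical
  set k : E → E → ENNReal := fun x y => S.indicator 1 (x, y)
  have hk : Measurable (Function.uncurry k) := measurable_one.indicator hS
  have hk_symm : ∀ x y, k x y = k y x := fun x y =>
    if_congr ⟨hsymm x y, hsymm y x⟩ rfl rfl
  have hpair : ouPair γ ρ S = ∫⁻ x, ouTransition γ ρ k 1 x ∂γ := by
    have h := lintegral_mul_ouTransition (γ := γ) (ρ := ρ) hk measurable_one measurable_one
    simp only [Pi.one_apply, one_mul, mul_one] at h
    rw [h, ← lintegral_indicator_one hS]
  have hpath : pathLaw γ ρ (2 ^ n) {w | ∀ t < 2 ^ n, (w t, w (t + 1)) ∈ S} =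
      ∫⁻ x, (ouTransition γ ρ k)^[2 ^ n] 1 x ∂γ := by
    rw [← lintegral_pathLaw_prod_mul hk _ measurable_one,
      ← lintegral_indicator_one (measurableSet_forall_consecutive hS _)]
    refine lintegral_congr fun w => ?_
    simp only [k, Set.indicator_apply, Pi.one_apply, mul_one, Finset.prod_ite_zero,
      Finset.prod_const_one, Finset.mem_range, Set.mem_ofPred_eq]
  rw [hpair, hpath]
  exact hγ.pow_le_lintegral_iterate_ouTransition hρ hk hk_symm n

theorem measurePreserving_pathLaw_pi {ι : Type*} [Fintype ι] (ρ : ℝ) (T : ℕ) :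
    MeasurePreserving (fun (v : ι → ℕ → E) (t : ℕ) (i : ι) => v i t)
      (Measure.pi fun _ : ι => pathLaw γ ρ T) (pathLaw (Measure.pi fun _ : ι => γ) ρ T) := by
  have hswap : Measurable fun (v : ι → ℕ → E) (t : ℕ) (i : ι) => v i t :=
    measurable_pi_lambda _ fun t => measurable_pi_lambda _ fun i =>
      (measurable_pi_apply t).comp (measurable_pi_apply i)
  refine ⟨hswap, ?_⟩
  induction T with
  | zero =>
    have hstart : MeasurePreserving (fun (x : ι → E) i (_ : ℕ) => x i)
        (Measure.pi fun _ : ι => γ) (Measure.pi fun _ : ι => pathLaw γ ρ 0) :=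
      measurePreserving_pi _ _ fun _ => ⟨measurable_const_path, rfl⟩
    rw [← hstart.map_eq, Measure.map_map hswap hstart.measurable]
    rfl
  | succ T ih =>
    have hcoords := (measurePreserving_pi _ _ fun _ : ι =>
      measurePreserving_pathStep (γ := γ) ρ T).comp
      ((measurePreserving_arrowProdEquivProdArrow (ℕ → E) E ι
        (fun _ => pathLaw γ ρ T) (fun _ => γ)).symm _)
    have hjoint := (measurePreserving_pathStep (γ := Measure.pi fun _ : ι => γ) ρ T).comp
      ((⟨hswap, ih⟩ : MeasurePreserving _ _ _).prod (MeasurePreserving.id _))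
    rw [← hcoords.map_eq, Measure.map_map hswap hcoords.measurable, ← hjoint.map_eq]
    congr 1
    ext p t i
    simp only [Function.comp_apply, pathStep, Prod.map]
    split_ifs <;> rfl

end PathLaw

/-! ### Solutions at well-separated times -/

section GaussianMoments

theorem lintegral_exp_mul_gaussianReal (a : ℝ) :
    ∫⁻ x, ENNReal.ofReal (Real.exp (a * x)) ∂gaussianReal 0 1 =
      ENNReal.ofReal (Real.exp (a ^ 2 / 2)) := by
  rw [← ofReal_integral_eq_lintegral_ofReal (integrable_exp_mul_gaussianReal a)
    (ae_of_all _ fun x => (Real.exp_pos _).le)]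
  have hmgf := congrFun (mgf_id_gaussianReal (μ := 0) (v := 1)) a
  simp only [mgf, id, zero_mul, NNReal.coe_one, one_mul, zero_add] at hmgf
  rw [hmgf]

theorem lintegral_exp_add_mul_ouStep {ρ : ℝ} (hρ : |ρ| ≤ 1) (b c x : ℝ) :
    ∫⁻ z, ENNReal.ofReal (Real.exp (c + b * ouStep ρ x z)) ∂gaussianReal 0 1 =
      ENNReal.ofReal (Real.exp (b ^ 2 * (1 - ρ ^ 2) / 2)) *
        ENNReal.ofReal (Real.exp (c + b * ρ * x)) := by
  calc _ = ∫⁻ z, ENNReal.ofReal (Real.exp (c + b * ρ * x)) *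
        ENNReal.ofReal (Real.exp (b * √(1 - ρ ^ 2) * z)) ∂gaussianReal 0 1 := by
        refine lintegral_congr fun z => ?_
        rw [← ENNReal.ofReal_mul (Real.exp_pos _).le, ← Real.exp_add, ouStep, smul_eq_mul,
          smul_eq_mul]
        congr 2
        ring
    _ = _ := by
        rw [lintegral_const_mul _ (by fun_prop), lintegral_exp_mul_gaussianReal, mul_comm]
        congr 3
        linear_combination b ^ 2 / 2 * sq_add_sqrt_one_sub_sq_sq hρ

variable {ρ : ℝ} {s t T : ℕ}

theorem lintegral_exp_eval_pathLaw (hρ : |ρ| ≤ 1) (htT : t ≤ T) (a b : ℝ) :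
    ∫⁻ w, ENNReal.ofReal (Real.exp (a * w t + b * w t)) ∂pathLaw (gaussianReal 0 1) ρ T =
      ENNReal.ofReal (Real.exp ((a ^ 2 + b ^ 2 + 2 * a * b) / 2)) := by
  simp only [← add_mul]
  rw [((reflectionInvariant_gaussianReal 1).measurePreserving_eval_pathLaw hρ htT).lintegral_comp
    (f := fun x => ENNReal.ofReal (Real.exp ((a + b) * x))) (by fun_prop),
    lintegral_exp_mul_gaussianReal]
  congr 3
  ring

theorem lintegral_exp_eval_eval_pathLaw (hρ : |ρ| ≤ 1) (hst : s ≤ t) (htT : t ≤ T) (a b : ℝ) :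
    ∫⁻ w, ENNReal.ofReal (Real.exp (a * w s + b * w t)) ∂pathLaw (gaussianReal 0 1) ρ T =
      ENNReal.ofReal (Real.exp ((a ^ 2 + b ^ 2 + 2 * a * b * ρ ^ (t - s)) / 2)) := by
  obtain rfl | hst := hst.eq_or_lt
  · simpa only [tsub_self, pow_zero, mul_one] using lintegral_exp_eval_pathLaw hρ htT a b
  induction T generalizing s t a b with
  | zero => omega
  | succ T ih =>
    rw [lintegral_pathLaw_succ ρ T (by fun_prop)]
    obtain htT | rfl := Nat.le_succ_iff.mp htT
    · simp only [pathStep_of_le htT, pathStep_of_le (hst.le.trans htT), lintegral_const,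
        measure_univ, mul_one]
      exact ih hst.le htT a b hst
    have hsT := Nat.lt_succ_iff.mp hst
    simp only [pathStep_of_le hsT, pathStep_succ, lintegral_exp_add_mul_ouStep hρ]
    have hprev : ∫⁻ w, ENNReal.ofReal (Real.exp (a * w s + b * ρ * w T))
          ∂pathLaw (gaussianReal 0 1) ρ T =
        ENNReal.ofReal (Real.exp ((a ^ 2 + (b * ρ) ^ 2 + 2 * a * (b * ρ) * ρ ^ (T - s)) / 2)) := by
      obtain rfl | hsT := hsT.eq_or_lt
      · simpa only [tsub_self, pow_zero, mul_one] using
          lintegral_exp_eval_pathLaw hρ le_rfl a (b * ρ)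
      · exact ih hsT.le le_rfl a (b * ρ) hsT
    rw [lintegral_const_mul _ (by fun_prop), hprev, ← ENNReal.ofReal_mul (Real.exp_pos _).le,
      ← Real.exp_add, Nat.succ_sub hsT, pow_succ ρ (T - s)]
    congr 2
    ring

theorem lintegral_pi_prod_eq_prod {ι α : Type*} [Fintype ι] [MeasurableSpace α] {μ : Measure α}
    [IsProbabilityMeasure μ] {f : ι → α → ENNReal} (hf : ∀ i, Measurable (f i)) :
    ∫⁻ x : ι → α, ∏ i, f i (x i) ∂(Measure.pi fun _ => μ) = ∏ i, ∫⁻ x, f i x ∂μ := by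
  rw [lintegral_prod_eq_prod_lintegral_of_indepFun Finset.univ (fun i (x : ι → α) => f i (x i))
    (iIndepFun_pi fun i => (hf i).aemeasurable) fun i => (hf i).comp (measurable_pi_apply i)]
  exact Finset.prod_congr rfl fun i _ =>
    (measurePreserving_eval (fun _ : ι => μ) i).lintegral_comp (hf i)

theorem lintegral_exp_sum_pathLaw {ι : Type*} [Fintype ι] (hρ : |ρ| ≤ 1) (hst : s ≤ t)
    (htT : t ≤ T) (a b : ι → ℝ) :
    ∫⁻ w, ENNReal.ofReal (Real.exp (∑ i, (a i * w s i + b i * w t i)))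
        ∂pathLaw (Measure.pi fun _ : ι => gaussianReal 0 1) ρ T =
      ENNReal.ofReal (Real.exp (∑ i, (a i ^ 2 + b i ^ 2 + 2 * a i * b i * ρ ^ (t - s)) / 2)) := by
  have hprod (x : ι → ℝ) : ENNReal.ofReal (Real.exp (∑ i, x i)) =
      ∏ i, ENNReal.ofReal (Real.exp (x i)) := by
    rw [Real.exp_sum, ENNReal.ofReal_prod_of_nonneg fun i _ => (Real.exp_pos _).le]
  rw [← (measurePreserving_pathLaw_pi ρ T).lintegral_comp (by fun_prop)]
  simp only [hprod]
  rw [lintegral_pi_prod_eq_prod (f := fun i (v : ℕ → ℝ) =>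
    ENNReal.ofReal (Real.exp (a i * v s + b i * v t))) fun i => by fun_prop]
  simp only [lintegral_exp_eval_eval_pathLaw hρ hst htT]

end GaussianMoments

theorem measure_le_le_exp_mul_lintegral {Ω : Type*} [MeasurableSpace Ω] {μ : Measure Ω}
    {X : Ω → ℝ} (hX : Measurable X) {l : ℝ} (hl : 0 ≤ l) (c : ℝ) :
    μ {ω | X ω ≤ c} ≤
      ENNReal.ofReal (Real.exp (l * c)) * ∫⁻ ω, ENNReal.ofReal (Real.exp (-l * X ω)) ∂μ := by
  rw [← lintegral_indicator_one (measurableSet_le hX measurable_const),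
    ← lintegral_const_mul _ (by fun_prop)]
  refine lintegral_mono (Set.indicator_le fun ω hω => ?_)
  rw [← ENNReal.ofReal_mul (Real.exp_pos _).le, ← Real.exp_add, Pi.one_apply,
    ENNReal.one_le_ofReal, Real.one_le_exp_iff]
  nlinarith [mul_nonneg hl (sub_nonneg.mpr (show X ω ≤ c from hω))]

section Bonferroni

variable {Ω ι : Type*} [MeasurableSpace Ω] {μ : Measure Ω} [IsProbabilityMeasure μ] {A : ι → Set Ω}
  {s : Finset ι} {q r : ℝ}

theorem le_measureReal_biUnion_finset (hA : ∀ i, MeasurableSet (A i))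
    (hq : ∀ i ∈ s, q ≤ μ.real (A i))
    (hr : (s : Set ι).Pairwise fun i j => μ.real (A i ∩ A j) ≤ r) :
    s.card * q - s.card * (s.card - 1) / 2 * r ≤ μ.real (⋃ i ∈ s, A i) := by
  classical
  induction s using Finset.induction_on with
  | empty => simp
  | insert k s hk ih =>
    have hoverlap : μ.real ((⋃ i ∈ s, A i) ∩ A k) ≤ s.card * r := by
      rw [Set.iUnion₂_inter]
      refine (measureReal_biUnion_finset_le _ _).trans
        ((Finset.sum_le_card_nsmul _ _ r fun i hi => ?_).trans (by simp))
      exact hr (Finset.mem_coe.mpr (Finset.mem_insert_of_mem hi))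
        (Finset.mem_coe.mpr (Finset.mem_insert_self k s)) (ne_of_mem_of_not_mem hi hk)
    have hsplit := measureReal_union_add_inter (μ := μ) (s := ⋃ i ∈ s, A i) (hA k)
      (measure_ne_top _ _)
    have hrest := ih (fun i hi => hq i (Finset.mem_insert_of_mem hi))
      (hr.mono (Finset.coe_subset.mpr (Finset.subset_insert k s)))
    have hlast := hq k (Finset.mem_insert_self k s)
    rw [Finset.set_biUnion_insert, Set.union_comm, Finset.card_insert_of_notMem hk]
    push_cast
    nlinarith

theorem measureReal_biInter_compl_le (hA : ∀ i, MeasurableSet (A i))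
    (hq : ∀ i ∈ s, q ≤ μ.real (A i))
    (hr : (s : Set ι).Pairwise fun i j => μ.real (A i ∩ A j) ≤ r)
    (hqr : (s.card - 1) * r ≤ q) : μ.real (⋂ i ∈ s, (A i)ᶜ) ≤ 1 - s.card * q / 2 := by
  rw [← Set.compl_iUnion₂, probReal_compl_eq_one_sub (s.measurableSet_biUnion fun i _ => hA i)]
  nlinarith [le_measureReal_biUnion_finset hA hq hr, Nat.cast_nonneg (α := ℝ) s.card]

end Bonferroni

theorem sq_eq_one_of_mem_cube {N : ℕ} {σ : Fin N → ℝ} (hσ : σ ∈ cube N) (j : Fin N) :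
    σ j ^ 2 = 1 := (sq _).trans (mul_self_eq_one_iff.mpr (hσ j))

theorem measurePreserving_sum_mul_div_sqrt {N : ℕ} (hN : 0 < N) {σ : Fin N → ℝ}
    (hσ : σ ∈ cube N) :
    MeasurePreserving (fun g : Fin N → ℝ => (∑ j, g j * σ j) / √N)
      (Measure.pi fun _ => gaussianReal 0 1) (gaussianReal 0 1) := by
  refine ⟨by fun_prop, ?_⟩
  set v : EuclideanSpace ℝ (Fin N) := WithLp.toLp 2 fun j => σ j / √N with hv
  have hnorm : ‖v‖ ^ 2 = 1 := by
    rw [EuclideanSpace.real_norm_sq_eq]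
    simp [hv, div_pow, sq_eq_one_of_mem_cube hσ, hN.ne']
  have hinner : (fun g : Fin N → ℝ => (∑ j, g j * σ j) / √N) =
      (innerSL ℝ v) ∘ (WithLp.toLp 2 : (Fin N → ℝ) → EuclideanSpace ℝ (Fin N)) := by
    ext g
    simp only [Function.comp_apply, innerSL_apply_apply, PiLp.inner_apply, hv, Finset.sum_div]
    exact Finset.sum_congr rfl fun j _ => by simp; ring
  rw [hinner, ← Measure.map_map (innerSL ℝ v).continuous.measurable (by fun_prop),
    map_pi_eq_stdGaussian, IsGaussian.map_eq_gaussianReal, integral_strongDual_stdGaussian,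
    variance_dual_stdGaussian]
  congr 1
  rw [innerSL_apply_norm, hnorm]
  simp

section Rows

variable {N : ℕ} {ρ : ℝ}

theorem pathLaw_row_lt (hN : 0 < N) {σ : Fin N → ℝ} (hσ : σ ∈ cube N) (hρ : |ρ| ≤ 1) {t T : ℕ}
    (htT : t ≤ T) (κ : ℝ) :
    pathLaw (Measure.pi fun _ : Fin N => gaussianReal 0 1) ρ T
      {w | (∑ j, w t j * σ j) / √N < κ} = gaussianReal 0 1 (Set.Iio κ) :=
  have heval := (reflectionInvariant_gaussianReal 1).pi.measurePreserving_eval_pathLaw hρ htT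
  ((measurePreserving_sum_mul_div_sqrt hN hσ).comp heval).measure_preimage
    measurableSet_Iio.nullMeasurableSet

theorem lintegral_exp_row_add_row {σ τ : Fin N → ℝ} (hN : 0 < N) (hσ : σ ∈ cube N)
    (hτ : τ ∈ cube N) (hρ : |ρ| ≤ 1) {s t T : ℕ} (hst : s ≤ t) (htT : t ≤ T) (l : ℝ) :
    ∫⁻ w, ENNReal.ofReal (Real.exp (-l * ((∑ j, w s j * σ j) / √N + (∑ j, w t j * τ j) / √N)))
        ∂pathLaw (Measure.pi fun _ : Fin N => gaussianReal 0 1) ρ T =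
      ENNReal.ofReal (Real.exp (l ^ 2 * (1 + ρ ^ (t - s) * (∑ j, σ j * τ j) / N))) := by
  have hNr : (0 : ℝ) < N := by exact_mod_cast hN
  have hlinear (w : ℕ → Fin N → ℝ) :
      -l * ((∑ j, w s j * σ j) / √N + (∑ j, w t j * τ j) / √N) =
        ∑ j, (-l * σ j / √N * w s j + -l * τ j / √N * w t j) := by
    rw [Finset.sum_div, Finset.sum_div, ← Finset.sum_add_distrib, Finset.mul_sum]
    exact Finset.sum_congr rfl fun j _ => by ring
  simp only [hlinear]
  rw [lintegral_exp_sum_pathLaw hρ hst htT]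
  have hterm (j : Fin N) : ((-l * σ j / √N) ^ 2 + (-l * τ j / √N) ^ 2 +
      2 * (-l * σ j / √N) * (-l * τ j / √N) * ρ ^ (t - s)) / 2 =
      l ^ 2 / N + l ^ 2 * ρ ^ (t - s) / N * (σ j * τ j) := by
    calc _ = (l ^ 2 * (σ j ^ 2 + τ j ^ 2) + 2 * l ^ 2 * ρ ^ (t - s) * (σ j * τ j)) /
          (2 * √(N : ℝ) ^ 2) := by ring
      _ = _ := by
          rw [sq_eq_one_of_mem_cube hσ, sq_eq_one_of_mem_cube hτ, Real.sq_sqrt hNr.le]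
          field_simp
          ring
  simp only [hterm, Finset.sum_add_distrib, ← Finset.mul_sum, Finset.sum_const, Finset.card_univ,
    Fintype.card_fin, nsmul_eq_mul]
  congr 2
  field_simp

theorem pathLaw_row_lt_inter_le (hN : 0 < N) {σ τ : Fin N → ℝ} (hσ : σ ∈ cube N)
    (hτ : τ ∈ cube N) (hρ : |ρ| ≤ 1) {s t T : ℕ} (hst : s ≤ t) (htT : t ≤ T)
    {κ δ : ℝ} (hκ : κ ≤ 0) (hδ : δ < 1)
    (hsep : ρ ^ (t - s) * (∑ j, σ j * τ j) / N ≤ 1 - 2 * δ) :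
    pathLaw (Measure.pi fun _ : Fin N => gaussianReal 0 1) ρ T
      ({w | (∑ j, w s j * σ j) / √N < κ} ∩ {w | (∑ j, w t j * τ j) / √N < κ}) ≤
      ENNReal.ofReal (Real.exp (-(κ ^ 2 * (1 + δ) / 2))) := by
  -- `l` minimizes the Chernoff exponent `2 * l * κ + 2 * l ^ 2 * (1 - δ)`
  set l : ℝ := -κ / (2 * (1 - δ)) with hl
  have hl0 : 0 ≤ l := div_nonneg (by linarith) (by linarith)
  have hle : -κ * (1 + δ) / 2 ≤ l := by
    rw [hl, div_le_div_iff₀ two_pos (by linarith)]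
    nlinarith [mul_nonneg (by linarith : 0 ≤ -κ) (sq_nonneg δ)]
  have hopt : l * (2 * (1 - δ)) = -κ := div_mul_cancel₀ _ (by linarith)
  have hcorr := mul_le_mul_of_nonneg_left hsep (sq_nonneg l)
  calc _ ≤ pathLaw (Measure.pi fun _ : Fin N => gaussianReal 0 1) ρ T
        {w | (∑ j, w s j * σ j) / √N + (∑ j, w t j * τ j) / √N ≤ 2 * κ} :=
        measure_mono <| by
          rintro w ⟨hs, ht⟩
          simp only [Set.mem_ofPred_eq] at hs ht ⊢
          linarith
    _ ≤ ENNReal.ofReal (Real.exp (l * (2 * κ))) *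
        ENNReal.ofReal (Real.exp (l ^ 2 * (1 + ρ ^ (t - s) * (∑ j, σ j * τ j) / N))) := by
        rw [← lintegral_exp_row_add_row hN hσ hτ hρ hst htT l]
        exact measure_le_le_exp_mul_lintegral (by fun_prop) hl0 _
    _ ≤ _ := by
        rw [← ENNReal.ofReal_mul (Real.exp_pos _).le, ← Real.exp_add]
        refine ENNReal.ofReal_le_ofReal (Real.exp_le_exp.mpr ?_)
        nlinarith

end Rows

theorem pathLaw_pi_forall_mem {ι E : Type*} [Fintype ι] [AddCommGroup E] [Module ℝ E]
    [MeasurableSpace E] [MeasurableAdd₂ E] [MeasurableConstSMul ℝ E] {γ : Measure E}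
    [IsProbabilityMeasure γ] (ρ : ℝ) (T : ℕ) {R : Set (ℕ → E)} (hR : MeasurableSet R) :
    pathLaw (Measure.pi fun _ : ι => γ) ρ T {w | ∀ i, (fun t => w t i) ∈ R} =
      pathLaw γ ρ T R ^ Fintype.card ι := by
  have hmeas : MeasurableSet {w : ℕ → ι → E | ∀ i, (fun t => w t i) ∈ R} := by
    rw [Set.ofPred_forall]
    exact .iInter fun i =>
      (show Measurable fun (w : ℕ → ι → E) (t : ℕ) => w t i by fun_prop) hR
  have hpre : (fun (v : ι → ℕ → E) (t : ℕ) (i : ι) => v i t) ⁻¹'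
      {w | ∀ i, (fun t => w t i) ∈ R} = Set.univ.pi fun _ => R := by
    ext v
    simp only [Set.mem_univ_pi]
    rfl
  rw [← (measurePreserving_pathLaw_pi ρ T).measure_preimage hmeas.nullMeasurableSet, hpre,
    Measure.pi_pi, Finset.prod_const, Finset.card_univ]

theorem pathLaw_forall_mem_solutions_le {M N : ℕ} (hN : 0 < N) {ρ : ℝ} (hρ : |ρ| ≤ 1)
    {κ δ : ℝ} (hκ : κ ≤ 0) (hδ : δ < 1) {m T : ℕ} {t : Fin m → ℕ} {σ : Fin m → Fin N → ℝ}
    (hσ : ∀ i, σ i ∈ cube N) (htT : ∀ i, t i ≤ T) (hmono : ∀ i, ∀ j < i, t j ≤ t i)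
    (hsep : ∀ i, ∀ j < i, ρ ^ (t i - t j) * (∑ l, σ j l * σ i l) / N ≤ 1 - 2 * δ)
    (hm : (m - 1) * Real.exp (-(κ ^ 2 * (1 + δ) / 2)) ≤ (gaussianReal 0 1).real (Set.Iio κ)) :
    pathLaw (disorderLaw M N) ρ T {w | ∀ i, σ i ∈ solutions (w (t i)) (Set.Ici κ)} ≤
      ENNReal.ofReal (1 - m * (gaussianReal 0 1).real (Set.Iio κ) / 2) ^ M := by
  set μ := pathLaw (Measure.pi fun _ : Fin N => gaussianReal 0 1) ρ T
  set A : Fin m → Set (ℕ → Fin N → ℝ) := fun i => {w | (∑ j, w (t i) j * σ i j) / √N < κ}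
  have hA (i) : MeasurableSet (A i) := measurableSet_lt (by fun_prop) measurable_const
  have hsingle (i : Fin m) : (gaussianReal 0 1).real (Set.Iio κ) ≤ μ.real (A i) :=
    (congrArg ENNReal.toReal (pathLaw_row_lt hN (hσ i) hρ (htT i) κ)).ge
  have hpair {i j : Fin m} (hij : j < i) :
      μ.real (A j ∩ A i) ≤ Real.exp (-(κ ^ 2 * (1 + δ) / 2)) :=
    ENNReal.toReal_le_of_le_ofReal (Real.exp_pos _).le (pathLaw_row_lt_inter_le hN (hσ j) (hσ i)
      hρ (hmono i j hij) (htT i) hκ hδ (hsep i j hij))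
  have hrow := measureReal_biInter_compl_le (μ := μ) (s := Finset.univ) hA
    (fun i _ => hsingle i)
    (fun i _ j _ hij => hij.lt_or_gt.elim hpair fun h =>
      (congrArg μ.real (Set.inter_comm (A i) (A j))).trans_le (hpair h))
    (by simpa only [Finset.card_univ, Fintype.card_fin] using hm)
  rw [Finset.card_univ, Fintype.card_fin] at hrow
  set R := ⋂ i ∈ Finset.univ, (A i)ᶜ
  have hR : MeasurableSet R := Finset.univ.measurableSet_biInter fun i _ => (hA i).compl
  calc _ ≤ pathLaw (disorderLaw M N) ρ T {w | ∀ r, (fun s => w s r) ∈ R} := by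
        refine measure_mono fun w hw r => Set.mem_iInter₂.mpr fun i _ => ?_
        exact not_lt.mpr (Set.mem_Ici.mp ((hw i).2 r))
    _ = μ R ^ M := by rw [disorderLaw, pathLaw_pi_forall_mem ρ T hR, Fintype.card_fin]
    _ ≤ _ := by
        gcongr
        rw [← ofReal_measureReal]
        exact ENNReal.ofReal_le_ofReal hrow

/-! ### Separated times and clusters -/

/-- The point of the cube with sign pattern `b`. -/
def cubePoint {N : ℕ} (b : Fin N → Bool) : Fin N → ℝ := fun j => if b j then 1 else -1

theorem cubePoint_mem_cube {N : ℕ} (b : Fin N → Bool) : cubePoint b ∈ cube N := fun j => by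
  cases hb : b j <;> simp [cubePoint, hb]

theorem sum_cubePoint_mul {N : ℕ} (b c : Fin N → Bool) :
    ∑ j, cubePoint b j * cubePoint c j = N - 2 * hammingDist b c := by
  have hterm (j : Fin N) :
      cubePoint b j * cubePoint c j = 1 - 2 * (if b j ≠ c j then 1 else 0) := by
    cases hb : b j <;> cases hc : c j <;> norm_num [cubePoint, hb, hc]
  simp only [hterm, Finset.sum_sub_distrib, ← Finset.mul_sum, Finset.sum_boole]
  simp [hammingDist]

section SeparatedTimes

variable {N : ℕ} {ρ δ : ℝ} {x : ℕ → Fin N → Bool}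

/-- Times `s` and `t` are decorrelated along `x` if the correlation `ρ ^ (t - s)` of the disorders,
multiplied by the overlap of the points visited, is bounded away from `1`. -/
def IsDecorrelated (ρ δ : ℝ) (x : ℕ → Fin N → Bool) (s t : ℕ) : Prop :=
  ρ ^ (t - s) * (∑ l, cubePoint (x s) l * cubePoint (x t) l) / N ≤ 1 - 2 * δ

theorem isDecorrelated_of_pow_le (hN : 0 < N) (h0 : 0 ≤ ρ) (h1 : ρ ≤ 1) {g s t : ℕ}
    (hg : ρ ^ g ≤ 1 - 2 * δ) (hst : s + g ≤ t) : IsDecorrelated ρ δ x s t := by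
  have hNr : (0 : ℝ) < N := by exact_mod_cast hN
  have hpow : ρ ^ (t - s) ≤ ρ ^ g := pow_le_pow_of_le_one h0 h1 (by omega)
  rw [IsDecorrelated, sum_cubePoint_mul, div_le_iff₀ hNr]
  nlinarith [mul_nonneg (pow_nonneg h0 (t - s)) (Nat.cast_nonneg (hammingDist (x s) (x t)))]

theorem isDecorrelated_of_lt_hammingDist (hN : 0 < N) (h0 : 0 ≤ ρ) (h1 : ρ ≤ 1)
    (hδ : 2 * δ ≤ 1) {s t : ℕ} (hd : δ * N < hammingDist (x s) (x t)) :
    IsDecorrelated ρ δ x s t := by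
  have hNr : (0 : ℝ) < N := by exact_mod_cast hN
  rw [IsDecorrelated, sum_cubePoint_mul, div_le_iff₀ hNr]
  calc _ ≤ ρ ^ (t - s) * ((1 - 2 * δ) * N) :=
        mul_le_mul_of_nonneg_left (by linarith) (pow_nonneg h0 _)
    _ ≤ _ := mul_le_of_le_one_left (mul_nonneg (by linarith) hNr.le) (pow_le_one₀ h0 h1)

theorem not_isDecorrelated_self (hN : 0 < N) (hδ : 0 < δ) (t : ℕ) :
    ¬ IsDecorrelated ρ δ x t t := by
  have hNr : (N : ℝ) ≠ 0 := by exact_mod_cast hN.ne'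
  rw [IsDecorrelated, sum_cubePoint_mul, hammingDist_self, tsub_self, pow_zero, Nat.cast_zero,
    mul_zero, sub_zero, one_mul, div_self hNr]
  linarith

/-- The greedy sequence of pairwise decorrelated times along `x`. The infimum is over a nonempty set
as soon as `ρ ^ g ≤ 1 - 2 * δ` for some `g`; otherwise it may be the junk value `0`. -/
def separatedTime (ρ δ : ℝ) (x : ℕ → Fin N → Bool) (n : ℕ) : ℕ :=
  sInf {t | ∀ i : Fin n, separatedTime ρ δ x i ≤ t ∧
    IsDecorrelated ρ δ x (separatedTime ρ δ x i) t}
termination_by n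

theorem separatedTime_le_and_isDecorrelated (hN : 0 < N) (h0 : 0 ≤ ρ) (h1 : ρ ≤ 1) {g : ℕ}
    (hg : ρ ^ g ≤ 1 - 2 * δ) {i n : ℕ} (hin : i < n) :
    separatedTime ρ δ x i ≤ separatedTime ρ δ x n ∧
      IsDecorrelated ρ δ x (separatedTime ρ δ x i) (separatedTime ρ δ x n) := by
  obtain ⟨b, hb⟩ := (Set.finite_range fun i : Fin n => separatedTime ρ δ x i).bddAbove
  have hfar (i : Fin n) : separatedTime ρ δ x i + g ≤ b + g :=
    Nat.add_le_add_right (hb ⟨i, rfl⟩) g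
  have hne : {t | ∀ i : Fin n, separatedTime ρ δ x i ≤ t ∧
      IsDecorrelated ρ δ x (separatedTime ρ δ x i) t}.Nonempty :=
    ⟨b + g, fun i => ⟨le_of_add_le_left (hfar i), isDecorrelated_of_pow_le hN h0 h1 hg (hfar i)⟩⟩
  have hmem := Nat.sInf_mem hne
  rw [← separatedTime] at hmem
  exact hmem ⟨i, hin⟩

theorem separatedTime_le_mul (hN : 0 < N) (h0 : 0 ≤ ρ) (h1 : ρ ≤ 1) {g : ℕ}
    (hg : ρ ^ g ≤ 1 - 2 * δ) (n : ℕ) : separatedTime ρ δ x n ≤ n * g := by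
  induction n with
  | zero =>
    rw [separatedTime, zero_mul]
    exact Nat.sInf_le fun i => i.elim0
  | succ n ih =>
    have hnext : separatedTime ρ δ x (n + 1) ≤ separatedTime ρ δ x n + g := by
      rw [separatedTime]
      refine Nat.sInf_le fun i => ?_
      have hi : separatedTime ρ δ x i ≤ separatedTime ρ δ x n := by
        rcases (Nat.lt_succ_iff.mp i.2).eq_or_lt with hi | hi
        · rw [hi]
        · exact (separatedTime_le_and_isDecorrelated hN h0 h1 hg hi).1
      exact ⟨hi.trans (Nat.le_add_right _ _),
        isDecorrelated_of_pow_le hN h0 h1 hg (Nat.add_le_add_right hi g)⟩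
    rw [Nat.succ_mul]
    exact hnext.trans (Nat.add_le_add_right ih g)

/-- Just before the greedy time the path was still within `δ * N` of an earlier point. -/
theorem exists_hammingDist_separatedTime_le (hN : 0 < N) (h0 : 0 ≤ ρ) (h1 : ρ ≤ 1) (hδ0 : 0 < δ)
    (hδ1 : 2 * δ ≤ 1) {g T : ℕ} (hg : ρ ^ g ≤ 1 - 2 * δ)
    (hx : ∀ t < T, (hammingDist (x t) (x (t + 1)) : ℝ) ≤ δ * N) {n : ℕ} (hn : 0 < n)
    (hT : n * g ≤ T) :
    ∃ i < n, (hammingDist (x (separatedTime ρ δ x n)) (x (separatedTime ρ δ x i)) : ℝ) ≤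
      2 * δ * N := by
  set τ := separatedTime ρ δ x
  have hlt {i : ℕ} (hi : i < n) : τ i < τ n := by
    obtain ⟨hle, hdec⟩ := separatedTime_le_and_isDecorrelated (x := x) hN h0 h1 hg hi
    exact hle.lt_of_ne fun h => not_isDecorrelated_self hN hδ0 _ (h ▸ hdec)
  have hpos := (Nat.zero_le _).trans_lt (hlt hn)
  have hnot : ¬ ∀ i : Fin n, τ i ≤ τ n - 1 ∧ IsDecorrelated ρ δ x (τ i) (τ n - 1) :=
    Nat.notMem_of_lt_sInf (s := {t | ∀ i : Fin n, τ i ≤ t ∧ IsDecorrelated ρ δ x (τ i) t})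
      ((Nat.sub_lt hpos one_pos).trans_eq (separatedTime.eq_1 ρ δ x n))
  push Not at hnot
  obtain ⟨i, hi⟩ := hnot
  have hprev : (hammingDist (x (τ i)) (x (τ n - 1)) : ℝ) ≤ δ * N := not_lt.mp fun hd =>
    hi (Nat.le_sub_one_of_lt (hlt i.2)) (isDecorrelated_of_lt_hammingDist hN h0 h1 hδ1 hd)
  have hstep := hx (τ n - 1)
    ((Nat.sub_lt hpos one_pos).trans_le ((separatedTime_le_mul hN h0 h1 hg n).trans hT))
  rw [Nat.sub_one_add_one hpos.ne'] at hstep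
  have htriangle : (hammingDist (x (τ n)) (x (τ i)) : ℝ) ≤
      hammingDist (x (τ n - 1)) (x (τ n)) + hammingDist (x (τ i)) (x (τ n - 1)) := by
    rw [hammingDist_comm (x (τ n - 1)), hammingDist_comm (x (τ i))]
    exact_mod_cast hammingDist_triangle _ _ _
  exact ⟨i, i.2, by linarith⟩

end SeparatedTimes

theorem sum_exp_neg_mul_hammingDist {N : ℕ} (l : ℝ) (b : Fin N → Bool) :
    ∑ c : Fin N → Bool, Real.exp (-l * hammingDist c b) = (1 + Real.exp (-l)) ^ N := by
  have hprod (c : Fin N → Bool) : Real.exp (-l * hammingDist c b) =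
      ∏ j, if c j ≠ b j then Real.exp (-l) else 1 := by
    rw [Finset.prod_ite, Finset.prod_const, Finset.prod_const_one, mul_one, ← Real.exp_nat_mul,
      mul_comm]
    rfl
  have hcoord (j : Fin N) :
      ∑ β : Bool, (if β ≠ b j then Real.exp (-l) else 1) = 1 + Real.exp (-l) := by
    cases b j <;> simp [add_comm]
  have hexchange := Finset.prod_univ_sum (fun _ : Fin N => (Finset.univ : Finset Bool))
    (fun j β => if β ≠ b j then Real.exp (-l) else 1)
  rw [Fintype.piFinset_univ] at hexchange
  simp only [hprod, ← hexchange, hcoord, Finset.prod_const, Finset.card_univ, Fintype.card_fin]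

theorem card_hammingBall_le {N : ℕ} {l : ℝ} (hl : 0 ≤ l) (r : ℝ) (b : Fin N → Bool) :
    ((Finset.univ.filter fun c : Fin N → Bool => (hammingDist c b : ℝ) ≤ r).card : ℝ) ≤
      Real.exp (l * r + N * Real.exp (-l)) := by
  set ball := Finset.univ.filter fun c : Fin N → Bool => (hammingDist c b : ℝ) ≤ r
  have hchernoff : (ball.card : ℝ) * Real.exp (-l * r) ≤ (1 + Real.exp (-l)) ^ N := by
    rw [← sum_exp_neg_mul_hammingDist l b, ← nsmul_eq_mul]
    refine (Finset.card_nsmul_le_sum _ (fun c => Real.exp (-l * hammingDist c b)) _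
      fun c hc => Real.exp_le_exp.mpr ?_).trans
      (Finset.sum_le_univ_sum_of_nonneg fun c => (Real.exp_pos _).le)
    exact mul_le_mul_of_nonpos_left (Finset.mem_filter.mp hc).2 (neg_nonpos.mpr hl)
  have hpow : (1 + Real.exp (-l)) ^ N ≤ Real.exp (N * Real.exp (-l)) := by
    rw [Real.exp_nat_mul, add_comm]
    gcongr
    exact Real.add_one_le_exp _
  calc (ball.card : ℝ) = Real.exp (l * r) * (ball.card * Real.exp (-l * r)) := by
        rw [mul_left_comm, ← Real.exp_add, neg_mul, add_neg_cancel, Real.exp_zero, mul_one]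
    _ ≤ Real.exp (l * r) * Real.exp (N * Real.exp (-l)) := by
        gcongr
        exact hchernoff.trans hpow
    _ = _ := (Real.exp_add _ _).symm

/-- Tuples of sign patterns in which every entry but the first is close to an earlier one. -/
def clusters (N n : ℕ) (r : ℝ) : Finset (Fin (n + 1) → Fin N → Bool) :=
  open Classical in
  Finset.univ.filter fun σ => ∀ i, i ≠ 0 → ∃ j < i, (hammingDist (σ i) (σ j) : ℝ) ≤ r

theorem mem_clusters {N n : ℕ} {r : ℝ} {σ : Fin (n + 1) → Fin N → Bool} :
    σ ∈ clusters N n r ↔ ∀ i, i ≠ 0 → ∃ j < i, (hammingDist (σ i) (σ j) : ℝ) ≤ r := by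
  simp only [clusters, Finset.mem_filter, Finset.mem_univ, true_and]

theorem init_mem_clusters {N n : ℕ} {r : ℝ} {σ : Fin (n + 2) → Fin N → Bool}
    (hσ : σ ∈ clusters N (n + 1) r) : Fin.init σ ∈ clusters N n r := by
  rw [mem_clusters] at hσ ⊢
  intro i hi
  obtain ⟨j, hj, hd⟩ := hσ i.castSucc (Fin.castSucc_ne_zero_iff.mpr hi)
  have hjn : j.val < n + 1 := (Fin.lt_def.mp hj).trans i.2
  exact ⟨⟨j, hjn⟩, hj, hd⟩

open Classical in
theorem card_filter_init_eq_le {N n : ℕ} {l : ℝ} (hl : 0 ≤ l) (r : ℝ)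
    (τ : Fin (n + 1) → Fin N → Bool) :
    (((clusters N (n + 1) r).filter fun σ => Fin.init σ = τ).card : ℝ) ≤
      (n + 1) * Real.exp (l * r + N * Real.exp (-l)) := by
  set ball : Fin (n + 1) → Finset (Fin N → Bool) := fun j =>
    Finset.univ.filter fun c => (hammingDist c (τ j) : ℝ) ≤ r with hball
  have hcard : ((clusters N (n + 1) r).filter fun σ => Fin.init σ = τ).card ≤
      (Finset.univ.biUnion ball).card := by
    refine Finset.card_le_card_of_injOn (fun σ => σ (Fin.last _)) (fun σ hσ => ?_) ?_
    · obtain ⟨hmem, rfl⟩ := Finset.mem_filter.mp (Finset.mem_coe.mp hσ)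
      obtain ⟨j, hj, hd⟩ := mem_clusters.mp hmem (Fin.last (n + 1)) Fin.last_pos.ne'
      simp only [Finset.mem_coe, Finset.mem_biUnion, hball, Finset.mem_filter, Finset.mem_univ,
        true_and]
      exact ⟨⟨j, hj⟩, hd⟩
    · intro σ hσ σ' hσ' hlast
      rw [← Fin.snoc_init_self σ, ← Fin.snoc_init_self σ', (Finset.mem_filter.mp hσ).2,
        (Finset.mem_filter.mp hσ').2]
      exact congrArg _ hlast
  calc _ ≤ ∑ j, ((ball j).card : ℝ) := by exact_mod_cast hcard.trans Finset.card_biUnion_le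
    _ ≤ ∑ _j : Fin (n + 1), Real.exp (l * r + N * Real.exp (-l)) :=
        Finset.sum_le_sum fun j _ => card_hammingBall_le hl r _
    _ = _ := by simp

theorem card_clusters_le {N : ℕ} {l : ℝ} (hl : 0 ≤ l) (r : ℝ) (n : ℕ) :
    ((clusters N n r).card : ℝ) ≤
      2 ^ N * ((n + 1) * Real.exp (l * r + N * Real.exp (-l))) ^ n := by
  classical
  set V := Real.exp (l * r + N * Real.exp (-l))
  induction n with
  | zero =>
    simp only [pow_zero, mul_one]
    exact_mod_cast (Finset.card_le_univ (clusters N 0 r)).trans (by simp)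
  | succ n ih =>
    calc ((clusters N (n + 1) r).card : ℝ)
        = ∑ τ ∈ clusters N n r,
            (((clusters N (n + 1) r).filter fun σ => Fin.init σ = τ).card : ℝ) := by
          exact_mod_cast Finset.card_eq_sum_card_fiberwise fun σ hσ => init_mem_clusters hσ
      _ ≤ (clusters N n r).card * ((n + 1) * V) := by
          rw [← nsmul_eq_mul]
          exact Finset.sum_le_card_nsmul _ _ _ fun τ _ => card_filter_init_eq_le hl r τ
      _ ≤ 2 ^ N * ((n + 1) * V) ^ n * ((n + 1) * V) := by gcongr
      _ = 2 ^ N * ((n + 1) * V) ^ (n + 1) := by ring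
      _ ≤ _ := by
          push_cast
          gcongr
          linarith

/-! ### Union bound over clusters -/

section StablePairs

variable {M N : ℕ} {ρ κ δ r : ℝ}

/-- Pairs of disorders on which `a` outputs two solutions at Hamming distance at most `r`. -/
def stablePairs (κ r : ℝ) (a : (Fin M → Fin N → ℝ) → Fin N → Bool) :
    Set ((Fin M → Fin N → ℝ) × (Fin M → Fin N → ℝ)) :=
  {p | cubePoint (a p.1) ∈ solutions p.1 (Set.Ici κ) ∧
    cubePoint (a p.2) ∈ solutions p.2 (Set.Ici κ) ∧ (hammingDist (a p.1) (a p.2) : ℝ) ≤ r}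

/-- Disorder paths for which `σ i` is a solution at time `t i` for each `i`. The event is empty
unless the times are nondecreasing and, along `σ`, pairwise decorrelated. -/
def separatedSolutions (M : ℕ) (ρ κ δ : ℝ) {m : ℕ} (t : Fin m → ℕ) (σ : Fin m → Fin N → Bool) :
    Set (ℕ → Fin M → Fin N → ℝ) :=
  {w | (∀ i, ∀ j < i, t j ≤ t i ∧
      ρ ^ (t i - t j) * (∑ l, cubePoint (σ j) l * cubePoint (σ i) l) / N ≤ 1 - 2 * δ) ∧
    ∀ i, cubePoint (σ i) ∈ solutions (w (t i)) (Set.Ici κ)}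

theorem pathLaw_separatedSolutions_le (hN : 0 < N) (hρ : |ρ| ≤ 1) (hκ : κ ≤ 0) (hδ : δ < 1)
    {m T : ℕ} {t : Fin m → ℕ} (htT : ∀ i, t i ≤ T) (σ : Fin m → Fin N → Bool)
    (hm : (m - 1) * Real.exp (-(κ ^ 2 * (1 + δ) / 2)) ≤ (gaussianReal 0 1).real (Set.Iio κ)) :
    pathLaw (disorderLaw M N) ρ T (separatedSolutions M ρ κ δ t σ) ≤
      ENNReal.ofReal (Real.exp (-(M * (m * (gaussianReal 0 1).real (Set.Iio κ) / 2)))) := by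
  by_cases hsep : ∀ i, ∀ j < i, t j ≤ t i ∧
      ρ ^ (t i - t j) * (∑ l, cubePoint (σ j) l * cubePoint (σ i) l) / N ≤ 1 - 2 * δ
  · refine (measure_mono fun w hw => hw.2).trans
      ((pathLaw_forall_mem_solutions_le hN hρ hκ hδ (fun i => cubePoint_mem_cube (σ i)) htT
        (fun i j hj => (hsep i j hj).1) (fun i j hj => (hsep i j hj).2) hm).trans ?_)
    rw [← mul_neg, Real.exp_nat_mul, ENNReal.ofReal_pow (Real.exp_pos _).le]
    gcongr
    linarith [Real.add_one_le_exp (-(m * (gaussianReal 0 1).real (Set.Iio κ) / 2))]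
  · have hempty : separatedSolutions M ρ κ δ t σ = ∅ :=
      Set.eq_empty_of_forall_notMem fun w hw => hsep hw.1
    rw [hempty, measure_empty]
    exact zero_le

theorem stable_subset_iUnion_separatedSolutions (hN : 0 < N) (h0 : 0 ≤ ρ) (h1 : ρ ≤ 1)
    (hδ0 : 0 < δ) (hδ1 : 2 * δ ≤ 1) {n g T : ℕ} (hg : ρ ^ g ≤ 1 - 2 * δ) (hT : n * g ≤ T)
    (hT0 : 0 < T) (a : (Fin M → Fin N → ℝ) → Fin N → Bool) :
    {w : ℕ → Fin M → Fin N → ℝ | ∀ t < T, (w t, w (t + 1)) ∈ stablePairs κ (δ * N) a} ⊆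
      ⋃ t ∈ (Finset.univ : Finset (Fin (n + 1) → Fin (T + 1))), ⋃ σ ∈ clusters N n (2 * δ * N),
        separatedSolutions M ρ κ δ (fun i => t i) σ := by
  intro w hw
  have hsol (t : ℕ) (ht : t ≤ T) : cubePoint (a (w t)) ∈ solutions (w t) (Set.Ici κ) := by
    obtain ht | rfl := ht.lt_or_eq
    · exact (hw t ht).1
    · simpa only [Nat.sub_one_add_one hT0.ne'] using (hw (t - 1) (Nat.sub_lt hT0 one_pos)).2.1
  set x : ℕ → Fin N → Bool := fun t => a (w t)
  have hτT (i : Fin (n + 1)) : separatedTime ρ δ x i ≤ T :=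
    (separatedTime_le_mul hN h0 h1 hg i).trans
      ((Nat.mul_le_mul_right g (Nat.lt_succ_iff.mp i.2)).trans hT)
  refine Set.mem_iUnion₂.mpr ⟨fun i => ⟨separatedTime ρ δ x i, Nat.lt_succ_iff.mpr (hτT i)⟩,
    Finset.mem_univ _, Set.mem_iUnion₂.mpr ⟨fun i => x (separatedTime ρ δ x i),
      mem_clusters.mpr fun i hi => ?_,
      fun i j hj => separatedTime_le_and_isDecorrelated hN h0 h1 hg hj,
      fun i => hsol _ (hτT i)⟩⟩
  obtain ⟨j, hj, hd⟩ := exists_hammingDist_separatedTime_le hN h0 h1 hδ0 hδ1 hg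
    (fun t ht => (hw t ht).2.2) (Fin.pos_iff_ne_zero.mpr hi)
    ((Nat.mul_le_mul_right g (Nat.lt_succ_iff.mp i.2)).trans hT)
  exact ⟨⟨j, hj.trans i.2⟩, hj, hd⟩

theorem pathLaw_stablePairs_le (hN : 0 < N) (h0 : 0 ≤ ρ) (h1 : ρ ≤ 1)
    {l : ℝ} (hκ : κ ≤ 0) (hδ0 : 0 < δ) (hδ1 : 2 * δ ≤ 1) (hl : 0 ≤ l) {n g T : ℕ}
    (hg : ρ ^ g ≤ 1 - 2 * δ) (hT : n * g ≤ T) (hT0 : 0 < T)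
    (hn : n * Real.exp (-(κ ^ 2 * (1 + δ) / 2)) ≤ (gaussianReal 0 1).real (Set.Iio κ))
    (a : (Fin M → Fin N → ℝ) → Fin N → Bool) :
    pathLaw (disorderLaw M N) ρ T {w | ∀ t < T, (w t, w (t + 1)) ∈ stablePairs κ (δ * N) a} ≤
      ENNReal.ofReal ((T + 1) ^ (n + 1) *
        (2 ^ N * ((n + 1) * Real.exp (l * (2 * δ * N) + N * Real.exp (-l))) ^ n) *
        Real.exp (-(M * ((n + 1) * (gaussianReal 0 1).real (Set.Iio κ) / 2)))) := by
  set P := pathLaw (disorderLaw M N) ρ T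
  set C := clusters N n (2 * δ * N)
  set E := Real.exp (-(M * ((n + 1) * (gaussianReal 0 1).real (Set.Iio κ) / 2)))
  have hevent (t : Fin (n + 1) → Fin (T + 1)) (σ : Fin (n + 1) → Fin N → Bool) :
      P (separatedSolutions M ρ κ δ (fun i => t i) σ) ≤ ENNReal.ofReal E := by
    have h := pathLaw_separatedSolutions_le (M := M) (δ := δ) (t := fun i => (t i : ℕ)) hN
      (abs_le.mpr ⟨by linarith, h1⟩) hκ (by linarith) (fun i => Nat.lt_succ_iff.mp (t i).2) σ
      (by simpa only [Nat.cast_add_one, add_sub_cancel_right] using hn)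
    simpa only [Nat.cast_add_one] using h
  calc _ ≤ P (⋃ t ∈ (Finset.univ : Finset (Fin (n + 1) → Fin (T + 1))), ⋃ σ ∈ C,
        separatedSolutions M ρ κ δ (fun i => t i) σ) :=
        measure_mono (stable_subset_iUnion_separatedSolutions hN h0 h1 hδ0 hδ1 hg hT hT0 a)
    _ ≤ ∑ t : Fin (n + 1) → Fin (T + 1), ∑ σ ∈ C,
        P (separatedSolutions M ρ κ δ (fun i => t i) σ) :=
        (measure_biUnion_finset_le _ _).trans
          (Finset.sum_le_sum fun _ _ => measure_biUnion_finset_le _ _)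
    _ ≤ ∑ _ : Fin (n + 1) → Fin (T + 1), ∑ _ ∈ C, ENNReal.ofReal E :=
        Finset.sum_le_sum fun t _ => Finset.sum_le_sum fun σ _ => hevent t σ
    _ = ENNReal.ofReal ((T + 1) ^ (n + 1) * C.card * E) := by
        simp only [Finset.sum_const, Finset.card_univ, Fintype.card_fun, Fintype.card_fin,
          nsmul_eq_mul]
        rw [← ENNReal.ofReal_natCast C.card, ← ENNReal.ofReal_natCast,
          ← ENNReal.ofReal_mul (by positivity), ← ENNReal.ofReal_mul (by positivity)]
        push_cast
        rw [mul_assoc]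
    _ ≤ _ := by
        gcongr
        exact card_clusters_le hl _ n

end StablePairs

section Measurability

variable {α : Type*} [MeasurableSpace α] {N : ℕ} {a : α → Fin N → Bool}

theorem measurable_cubePoint (ha : Measurable a) : Measurable fun z => cubePoint (a z) :=
  (measurable_of_finite cubePoint).comp ha

theorem measurable_hammingDist {b : α → Fin N → Bool} (ha : Measurable a) (hb : Measurable b) :
    Measurable fun z => (hammingDist (a z) (b z) : ℝ) := by
  have hdist : Measurable fun q : (Fin N → Bool) × (Fin N → Bool) => (hammingDist q.1 q.2 : ℝ) :=
    measurable_of_finite _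
  simpa only [Function.comp_def] using hdist.comp (ha.prodMk hb)

theorem measurableSet_cubePoint_mem_solutions {M : ℕ} {G : α → Fin M → Fin N → ℝ}
    (hG : Measurable G) (ha : Measurable a) {I : Set ℝ} (hI : MeasurableSet I) :
    MeasurableSet {z | cubePoint (a z) ∈ solutions (G z) I} := by
  have hb := measurable_cubePoint ha
  have hinter : {z | cubePoint (a z) ∈ solutions (G z) I} =
      ⋂ i, (fun z => (∑ j, G z i j * cubePoint (a z) j) / √N) ⁻¹' I := by
    ext z
    exact ⟨fun h => Set.mem_iInter.mpr h.2,
      fun h => ⟨cubePoint_mem_cube _, Set.mem_iInter.mp h⟩⟩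
  rw [hinter]
  exact .iInter fun i =>
    (show Measurable fun z => (∑ j, G z i j * cubePoint (a z) j) / √N by fun_prop) hI

theorem measurableSet_stablePairs {M : ℕ} (κ r : ℝ) {a : (Fin M → Fin N → ℝ) → Fin N → Bool}
    (ha : Measurable a) : MeasurableSet (stablePairs κ r a) :=
  (measurableSet_cubePoint_mem_solutions measurable_fst (ha.comp measurable_fst)
    measurableSet_Ici).inter ((measurableSet_cubePoint_mem_solutions measurable_snd
      (ha.comp measurable_snd) measurableSet_Ici).inter
        (measurableSet_le (measurable_hammingDist (ha.comp measurable_fst)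
          (ha.comp measurable_snd)) measurable_const))

end Measurability

theorem reflectionInvariant_disorderLaw (M N : ℕ) : ReflectionInvariant (disorderLaw M N) :=
  (reflectionInvariant_gaussianReal 1).pi.pi

instance (M N : ℕ) : IsProbabilityMeasure (disorderLaw M N) := by
  unfold disorderLaw
  infer_instance

theorem ouPair_stablePairs_pow_le {M N : ℕ} (hN : 0 < N) {ρ : ℝ} (h0 : 0 ≤ ρ) (h1 : ρ ≤ 1)
    {κ δ l : ℝ} (hκ : κ ≤ 0) (hδ0 : 0 < δ) (hδ1 : 2 * δ ≤ 1) (hl : 0 ≤ l) {n g k : ℕ}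
    (hg : ρ ^ g ≤ 1 - 2 * δ) (hT : n * g ≤ 2 ^ k)
    (hn : n * Real.exp (-(κ ^ 2 * (1 + δ) / 2)) ≤ (gaussianReal 0 1).real (Set.Iio κ))
    {a : (Fin M → Fin N → ℝ) → Fin N → Bool} (ha : Measurable a) :
    ouPair (disorderLaw M N) ρ (stablePairs κ (δ * N) a) ^ 2 ^ k ≤
      ENNReal.ofReal (((2 ^ k : ℕ) + 1) ^ (n + 1) *
        (2 ^ N * ((n + 1) * Real.exp (l * (2 * δ * N) + N * Real.exp (-l))) ^ n) *
        Real.exp (-(M * ((n + 1) * (gaussianReal 0 1).real (Set.Iio κ) / 2)))) :=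
  ((reflectionInvariant_disorderLaw M N).ouPair_pow_le_pathLaw
    (abs_le.mpr ⟨by linarith, h1⟩) (measurableSet_stablePairs κ (δ * N) ha)
    (fun _ _ h => ⟨h.2.1, h.1, (congrArg Nat.cast (hammingDist_comm _ _)).trans_le h.2.2⟩) k).trans
      (pathLaw_stablePairs_le hN h0 h1 hκ hδ0 hδ1 hl hg hT (by positivity) hn a)

/-! ### Stability of rounded polynomials -/

/-- The entries of a matrix, as linear functionals. -/
def entry {M N : ℕ} (e : Fin M × Fin N) : (Fin M → Fin N → ℝ) →ₗ[ℝ] ℝ :=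
  LinearMap.proj e.2 ∘ₗ LinearMap.proj e.1

theorem hasFiniteMoments_entry {M N : ℕ} (e : Fin M × Fin N) :
    HasFiniteMoments (entry e) (disorderLaw M N) := fun p hp =>
  (memLp_id_gaussianReal' p hp).comp_measurePreserving
    ((measurePreserving_eval (fun _ : Fin N => gaussianReal 0 1) e.2).comp
      (measurePreserving_eval (fun _ : Fin M => Measure.pi fun _ : Fin N => gaussianReal 0 1) e.1))

theorem IsPolynomialOfDegree.lintegral_sub_sq_ouPair_le {M N D : ℕ} {Ω : Type*}
    {A : (Fin M → Fin N → ℝ) → Ω → Fin N → ℝ} (hA : IsPolynomialOfDegree D A) {ρ : ℝ} (h0 : 0 ≤ ρ)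
    (h1 : ρ ≤ 1) (ω : Ω) (j : Fin N) :
    ∫⁻ q, ENNReal.ofReal ((A q.1 ω j - A q.2 ω j) ^ 2) ∂ouPair (disorderLaw M N) ρ ≤
      ENNReal.ofReal (2 * (1 - ρ ^ (D + 1))) *
        ∫⁻ G, ENNReal.ofReal (A G ω j ^ 2) ∂disorderLaw M N := by
  obtain ⟨p, hp, hAp⟩ := hA ω j
  have hmem : (fun G => A G ω j) ∈ degreeLT entry (D + 1) := by
    rw [funext hAp]
    exact eval_mem_degreeLT entry hp
  exact (reflectionInvariant_disorderLaw M N).lintegral_sub_sq_ouPair_le hasFiniteMoments_entry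
    h0 h1 hmem

section Rounding

variable {N : ℕ}

instance : IsProbabilityMeasure (cond (volume : Measure ℝ) (Set.Icc (-1 : ℝ) 1)) :=
  cond_isProbabilityMeasure_of_finite (by simp) (by simp)

instance : IsProbabilityMeasure (roundingLaw N) := by
  unfold roundingLaw
  infer_instance

open Classical in
/-- The sign pattern of the rounding of `x` with thresholds `U`. -/
def roundBits (U x : Fin N → ℝ) : Fin N → Bool := fun j => decide (U j ≤ x j)

theorem cubePoint_roundBits (U x : Fin N → ℝ) :
    cubePoint (roundBits U x) = IsingPerceptron.round U x := by
  ext j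
  simp [cubePoint, roundBits, IsingPerceptron.round]

theorem measurable_roundBits :
    Measurable fun p : (Fin N → ℝ) × (Fin N → ℝ) => roundBits p.1 p.2 := by
  refine measurable_pi_lambda _ fun j => measurable_to_bool ?_
  have hpre : (fun p : (Fin N → ℝ) × (Fin N → ℝ) => roundBits p.1 p.2 j) ⁻¹' {true} =
      {p | p.1 j ≤ p.2 j} := by
    ext p
    simp [roundBits]
  rw [hpre]
  exact measurableSet_le (by fun_prop) (by fun_prop)

theorem cond_Icc_Ioc_le (x y : ℝ) :
    cond (volume : Measure ℝ) (Set.Icc (-1 : ℝ) 1) (Set.Ioc (min x y) (max x y)) ≤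
      ENNReal.ofReal (|x - y| / 2) := by
  rw [cond_apply measurableSet_Icc, Real.volume_Icc]
  calc _ ≤ (ENNReal.ofReal (1 - -1))⁻¹ * volume (Set.Ioc (min x y) (max x y)) := by
        gcongr
        exact Set.inter_subset_right
    _ = _ := by
        rw [Real.volume_Ioc, max_sub_min_eq_abs, ← ENNReal.ofReal_inv_of_pos (by norm_num),
          ← ENNReal.ofReal_mul (by norm_num), abs_sub_comm]
        congr 1
        ring

theorem ofReal_hammingDist_roundBits_le (U x y : Fin N → ℝ) :
    ENNReal.ofReal (hammingDist (roundBits U x) (roundBits U y)) ≤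
      ∑ j, (Set.Ioc (min (x j) (y j)) (max (x j) (y j))).indicator 1 (U j) := by
  rw [hammingDist, Finset.card_filter, Nat.cast_sum,
    ENNReal.ofReal_sum_of_nonneg fun j _ => Nat.cast_nonneg _]
  refine Finset.sum_le_sum fun j _ => ?_
  split_ifs with hj
  · rw [Set.indicator_of_mem, Pi.one_apply, Nat.cast_one, ENNReal.ofReal_one]
    by_cases hx : U j ≤ x j <;> by_cases hy : U j ≤ y j <;> simp_all [roundBits]
  · simp

theorem lintegral_hammingDist_roundBits_le (x y : Fin N → ℝ) :
    ∫⁻ U, ENNReal.ofReal (hammingDist (roundBits U x) (roundBits U y)) ∂roundingLaw N ≤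
      ∑ j, ENNReal.ofReal (|x j - y j| / 2) := by
  set J : Fin N → Set ℝ := fun j => Set.Ioc (min (x j) (y j)) (max (x j) (y j))
  have hJ (j : Fin N) : Measurable ((J j).indicator (1 : ℝ → ENNReal)) :=
    measurable_one.indicator measurableSet_Ioc
  calc _ ≤ ∫⁻ U, ∑ j, (J j).indicator 1 (U j) ∂roundingLaw N :=
        lintegral_mono fun U => ofReal_hammingDist_roundBits_le U x y
    _ = ∑ j, ∫⁻ U, (J j).indicator 1 (U j) ∂roundingLaw N :=
        lintegral_finsetSum _ fun j _ => (hJ j).comp (measurable_pi_apply j)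
    _ ≤ _ := by
        refine Finset.sum_le_sum fun j _ => ?_
        have heval := measurePreserving_eval
          (fun _ : Fin N => cond (volume : Measure ℝ) (Set.Icc (-1 : ℝ) 1)) j
        refine (heval.lintegral_comp (hJ j)).trans_le ?_
        rw [lintegral_indicator_one measurableSet_Ioc]
        exact cond_Icc_Ioc_le _ _

theorem abs_div_two_le {τ : ℝ} (hτ : 0 < τ) (u : ℝ) :
    |u| / 2 ≤ τ / 4 + 1 / (4 * τ) * u ^ 2 := by
  have hsum : τ / 4 + 1 / (4 * τ) * u ^ 2 = (τ ^ 2 + u ^ 2) / (4 * τ) := by field_simp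
  rw [hsum, div_le_div_iff₀ two_pos (by positivity), ← sq_abs u]
  nlinarith [sq_nonneg (τ - |u|)]

theorem lintegral_lintegral_hammingDist_roundBits_le {α : Type*} [MeasurableSpace α]
    {μ : Measure α} [IsProbabilityMeasure μ] {f g : α → Fin N → ℝ} (hf : Measurable f)
    (hg : Measurable g) {τ : ℝ} (hτ : 0 < τ) :
    ∫⁻ U, ∫⁻ z, ENNReal.ofReal (hammingDist (roundBits U (f z)) (roundBits U (g z))) ∂μ
        ∂roundingLaw N ≤
      ENNReal.ofReal (N * τ / 4) +
        ENNReal.ofReal (1 / (4 * τ)) * ∑ j, ∫⁻ z, ENNReal.ofReal ((f z j - g z j) ^ 2) ∂μ := by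
  have hdist : Measurable fun p : (Fin N → ℝ) × α =>
      ENNReal.ofReal (hammingDist (roundBits p.1 (f p.2)) (roundBits p.1 (g p.2))) :=
    (measurable_hammingDist
      (measurable_roundBits.comp (measurable_fst.prodMk (hf.comp measurable_snd)))
      (measurable_roundBits.comp (measurable_fst.prodMk (hg.comp measurable_snd)))).ennreal_ofReal
  have hsq (j : Fin N) : Measurable fun z => ENNReal.ofReal ((f z j - g z j) ^ 2) := by fun_prop
  rw [lintegral_lintegral_swap hdist.aemeasurable]
  calc _ ≤ ∫⁻ z, ∑ j, (ENNReal.ofReal (τ / 4) +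
          ENNReal.ofReal (1 / (4 * τ)) * ENNReal.ofReal ((f z j - g z j) ^ 2)) ∂μ := by
        refine lintegral_mono fun z => (lintegral_hammingDist_roundBits_le _ _).trans
          (Finset.sum_le_sum fun j _ => ?_)
        rw [← ENNReal.ofReal_mul (by positivity),
          ← ENNReal.ofReal_add (by positivity) (by positivity)]
        exact ENNReal.ofReal_le_ofReal (abs_div_two_le hτ _)
    _ = ∑ _j : Fin N, ENNReal.ofReal (τ / 4) + ∑ j, ENNReal.ofReal (1 / (4 * τ)) *
          ∫⁻ z, ENNReal.ofReal ((f z j - g z j) ^ 2) ∂μ := by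
        rw [lintegral_finsetSum _ fun j _ => by fun_prop, ← Finset.sum_add_distrib]
        refine Finset.sum_congr rfl fun j _ => ?_
        rw [lintegral_add_left measurable_const, lintegral_const_mul _ (hsq j), lintegral_const,
          measure_univ, mul_one]
    _ = _ := by
        rw [Finset.sum_const, Finset.card_univ, Fintype.card_fin, ← ENNReal.ofReal_nsmul,
          nsmul_eq_mul, mul_div_assoc, Finset.mul_sum]

end Rounding

section Algorithm

variable {M N D : ℕ} {Ω : Type*} [MeasurableSpace Ω] {P : Measure Ω} [IsProbabilityMeasure P]
  {A : (Fin M → Fin N → ℝ) → Ω → Fin N → ℝ} {ρ : ℝ}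

theorem secondMoment_eq_lintegral
    (hA : Measurable fun z : (Fin M → Fin N → ℝ) × Ω => A z.1 z.2) :
    secondMoment P A =
      ∫⁻ ω, ∑ j, ∫⁻ G, ENNReal.ofReal (A G ω j ^ 2) ∂disorderLaw M N ∂P := by
  have hsq (j : Fin N) : Measurable fun z : (Fin M → Fin N → ℝ) × Ω =>
      ENNReal.ofReal (A z.1 z.2 j ^ 2) :=
    (((measurable_pi_apply j).comp hA).pow_const 2).ennreal_ofReal
  simp only [secondMoment, ENNReal.ofReal_sum_of_nonneg fun _ _ => sq_nonneg _]
  rw [lintegral_finsetSum _ fun j _ => hsq j,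
    lintegral_finsetSum _ fun j _ => (hsq j).lintegral_prod_left']
  exact Finset.sum_congr rfl fun j _ => lintegral_prod_symm _ (hsq j).aemeasurable

theorem measurable_roundBits_comp
    (hA : Measurable fun z : (Fin M → Fin N → ℝ) × Ω => A z.1 z.2) :
    Measurable fun z : (Ω × (Fin N → ℝ)) × (Fin M → Fin N → ℝ) =>
      roundBits z.1.2 (A z.2 z.1.1) :=
  measurable_roundBits.comp ((measurable_snd.comp measurable_fst).prodMk
    (hA.comp (measurable_snd.prodMk (measurable_fst.comp measurable_fst))))

theorem lintegral_hammingDist_ouPair_le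
    (hA : Measurable fun z : (Fin M → Fin N → ℝ) × Ω => A z.1 z.2)
    (hD : IsPolynomialOfDegree D A) (h0 : 0 ≤ ρ) (h1 : ρ ≤ 1) {τ : ℝ} (hτ : 0 < τ) :
    ∫⁻ w, ∫⁻ q, ENNReal.ofReal (hammingDist (roundBits w.2 (A q.1 w.1))
        (roundBits w.2 (A q.2 w.1))) ∂ouPair (disorderLaw M N) ρ ∂P.prod (roundingLaw N) ≤
      ENNReal.ofReal (N * τ / 4) +
        ENNReal.ofReal ((1 - ρ ^ (D + 1)) / (2 * τ)) * secondMoment P A := by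
  have hA' (ω : Ω) : Measurable fun G => A G ω := hA.comp measurable_prodMk_right
  have hdist : Measurable fun z : (Ω × (Fin N → ℝ)) ×
      ((Fin M → Fin N → ℝ) × (Fin M → Fin N → ℝ)) => ENNReal.ofReal (hammingDist
        (roundBits z.1.2 (A z.2.1 z.1.1)) (roundBits z.1.2 (A z.2.2 z.1.1))) :=
    (measurable_hammingDist
      ((measurable_roundBits_comp hA).comp
        (measurable_fst.prodMk (measurable_fst.comp measurable_snd)))
      ((measurable_roundBits_comp hA).comp
        (measurable_fst.prodMk (measurable_snd.comp measurable_snd)))).ennreal_ofReal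
  have hcoef : ENNReal.ofReal (1 / (4 * τ)) * ENNReal.ofReal (2 * (1 - ρ ^ (D + 1))) =
      ENNReal.ofReal ((1 - ρ ^ (D + 1)) / (2 * τ)) := by
    rw [← ENNReal.ofReal_mul (by positivity)]
    congr 1
    field_simp
    ring
  rw [lintegral_prod _ hdist.lintegral_prod_right'.aemeasurable]
  calc _ ≤ ∫⁻ ω, (ENNReal.ofReal (N * τ / 4) + ENNReal.ofReal ((1 - ρ ^ (D + 1)) / (2 * τ)) *
          ∑ j, ∫⁻ G, ENNReal.ofReal (A G ω j ^ 2) ∂disorderLaw M N) ∂P := by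
        refine lintegral_mono fun ω => (lintegral_lintegral_hammingDist_roundBits_le
          ((hA' ω).comp measurable_fst) ((hA' ω).comp measurable_snd) hτ).trans ?_
        rw [← hcoef, mul_assoc, Finset.mul_sum (a := ENNReal.ofReal (2 * _))]
        gcongr with j
        exact hD.lintegral_sub_sq_ouPair_le h0 h1 ω j
    _ = _ := by
        rw [lintegral_add_left measurable_const, lintegral_const_mul' _ _ ENNReal.ofReal_ne_top,
          secondMoment_eq_lintegral hA, lintegral_const, measure_univ, mul_one]

theorem successProb_eq_lintegral
    (hA : Measurable fun z : (Fin M → Fin N → ℝ) × Ω => A z.1 z.2) {I : Set ℝ}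
    (hI : MeasurableSet I) :
    successProb P A I = ∫⁻ w, disorderLaw M N
      {G | cubePoint (roundBits w.2 (A G w.1)) ∈ solutions G I} ∂P.prod (roundingLaw N) := by
  have hmeas := measurableSet_cubePoint_mem_solutions measurable_snd
    (measurable_roundBits_comp hA) hI
  have hswap := Measure.measurePreserving_swap (μ := disorderLaw M N) (ν := P.prod (roundingLaw N))
  simp only [successProb, ← cubePoint_roundBits]
  exact (hswap.measure_preimage hmeas.nullMeasurableSet).trans (Measure.prod_apply hmeas)

end Algorithm

theorem ReflectionInvariant.sq_measure_le_ouPair_prod {E : Type*} [AddCommGroup E] [Module ℝ E]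
    [MeasurableSpace E] [MeasurableAdd₂ E] [MeasurableConstSMul ℝ E] {γ : Measure E}
    [IsProbabilityMeasure γ] (hγ : ReflectionInvariant γ) {ρ : ℝ} (h0 : 0 ≤ ρ) (h1 : ρ ≤ 1)
    {S : Set E} (hS : MeasurableSet S) : γ S ^ 2 ≤ ouPair γ ρ (S ×ˢ S) := by
  have h := hγ.sq_lintegral_le_lintegral_ouPair h0 h1 (measurable_one.indicator hS)
  rw [lintegral_indicator_one hS] at h
  refine h.trans_eq ?_
  rw [← lintegral_indicator_one (hS.prod hS)]
  exact lintegral_congr fun q => Set.indicator_prod_one.symm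

theorem ofReal_mul_lintegral_measure_lt_le {α β : Type*} [MeasurableSpace α] [MeasurableSpace β]
    {μ : Measure α} {ν : Measure β} [SFinite ν] {d : α → β → ℝ}
    (hd : Measurable fun z : α × β => d z.1 z.2) (r : ℝ) :
    ENNReal.ofReal r * ∫⁻ x, ν {y | r < d x y} ∂μ ≤ ∫⁻ x, ∫⁻ y, ENNReal.ofReal (d x y) ∂ν ∂μ := by
  rw [← lintegral_const_mul' _ _ ENNReal.ofReal_ne_top]
  refine lintegral_mono fun x => le_trans ?_ (mul_meas_ge_le_lintegral
    (hd.comp measurable_prodMk_left).ennreal_ofReal (ENNReal.ofReal r))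
  gcongr with y
  exact fun hy => ENNReal.ofReal_le_ofReal (le_of_lt hy)

section Stability

variable {M N : ℕ} {ρ : ℝ}

theorem exists_le_ouPair_stablePairs {W : Type*} [MeasurableSpace W] {Q : Measure W}
    [IsProbabilityMeasure Q] {a : W → (Fin M → Fin N → ℝ) → Fin N → Bool}
    (ha : Measurable fun z : W × (Fin M → Fin N → ℝ) => a z.1 z.2) (h0 : 0 ≤ ρ) (h1 : ρ ≤ 1)
    {κ p r : ℝ} (hp : 0 ≤ p)
    (hsucc : ENNReal.ofReal p ≤
      ∫⁻ w, disorderLaw M N {G | cubePoint (a w G) ∈ solutions G (Set.Ici κ)} ∂Q)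
    (hfar : ∫⁻ w, ouPair (disorderLaw M N) ρ {q | r < hammingDist (a w q.1) (a w q.2)} ∂Q ≤
      ENNReal.ofReal (p ^ 2 / 2)) :
    ∃ w, ENNReal.ofReal (p ^ 2 / 2) ≤ ouPair (disorderLaw M N) ρ (stablePairs κ r (a w)) := by
  set γ := disorderLaw M N
  set S : W → Set (Fin M → Fin N → ℝ) := fun w => {G | cubePoint (a w G) ∈ solutions G (Set.Ici κ)}
  have hS : MeasurableSet {z : W × (Fin M → Fin N → ℝ) | z.2 ∈ S z.1} :=
    measurableSet_cubePoint_mem_solutions measurable_snd ha measurableSet_Ici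
  have hfar_meas : Measurable fun w =>
      ouPair γ ρ {q | r < hammingDist (a w q.1) (a w q.2)} :=
    measurable_measure_prodMk_left (s := {z : W × (Fin M → Fin N → ℝ) × (Fin M → Fin N → ℝ) |
        r < hammingDist (a z.1 z.2.1) (a z.1 z.2.2)}) <|
      measurableSet_lt measurable_const <| measurable_hammingDist
        (ha.comp (measurable_fst.prodMk (measurable_fst.comp measurable_snd)))
        (ha.comp (measurable_fst.prodMk (measurable_snd.comp measurable_snd)))
  have hsplit (w : W) : γ (S w) ^ 2 ≤ ouPair γ ρ (stablePairs κ r (a w)) +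
      ouPair γ ρ {q | r < hammingDist (a w q.1) (a w q.2)} := by
    have hpair := (reflectionInvariant_disorderLaw M N).sq_measure_le_ouPair_prod h0 h1
      (S := S w) (measurable_prodMk_left hS)
    refine hpair.trans ((measure_mono fun q hq => ?_).trans (measure_union_le _ _))
    exact (le_or_gt _ r).imp (fun h => ⟨hq.1, hq.2, h⟩) id
  have haverage : ENNReal.ofReal (p ^ 2 / 2) ≤
      ∫⁻ w, ouPair γ ρ (stablePairs κ r (a w)) ∂Q := by
    refine (ENNReal.add_le_add_iff_right (ENNReal.ofReal_ne_top (r := p ^ 2 / 2))).mp ?_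
    calc _ = ENNReal.ofReal p ^ 2 := by
          rw [← ENNReal.ofReal_add (by positivity) (by positivity), add_halves,
            ENNReal.ofReal_pow hp]
      _ ≤ (∫⁻ w, γ (S w) ∂Q) ^ 2 := by gcongr
      _ ≤ ∫⁻ w, γ (S w) ^ 2 ∂Q := sq_lintegral_le (measurable_measure_prodMk_left hS)
      _ ≤ ∫⁻ w, (ouPair γ ρ (stablePairs κ r (a w)) +
            ouPair γ ρ {q | r < hammingDist (a w q.1) (a w q.2)}) ∂Q := lintegral_mono hsplit
      _ ≤ _ := by
          rw [lintegral_add_right _ hfar_meas]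
          gcongr
  have hfinite : ∫⁻ w, ouPair γ ρ (stablePairs κ r (a w)) ∂Q ≠ ⊤ :=
    ne_top_of_le_ne_top (measure_ne_top Q Set.univ)
      ((lintegral_mono fun w => prob_le_one).trans_eq lintegral_one)
  obtain ⟨w, hw⟩ := exists_lintegral_le hfinite
  exact ⟨w, haverage.trans hw⟩

theorem exists_stable_of_successProb {D : ℕ} (hN : 0 < N) {Ω : Type*} [MeasurableSpace Ω]
    {P : Measure Ω} [IsProbabilityMeasure P] {A : (Fin M → Fin N → ℝ) → Ω → Fin N → ℝ}
    (hA : Measurable fun z : (Fin M → Fin N → ℝ) × Ω => A z.1 z.2)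
    (hD : IsPolynomialOfDegree D A) {B : ℝ}
    (hB : secondMoment P A ≤ ENNReal.ofReal (B * N)) {κ p δ : ℝ} (hp : 0 < p) (hδ : 0 < δ)
    (h0 : 0 ≤ ρ) (h1 : ρ ≤ 1) (hρ : 2 * B * (1 - ρ ^ (D + 1)) ≤ δ ^ 2 * p ^ 4)
    (hsucc : ENNReal.ofReal p ≤ successProb P A (Set.Ici κ)) :
    ∃ a : (Fin M → Fin N → ℝ) → Fin N → Bool, Measurable a ∧
      ENNReal.ofReal (p ^ 2 / 2) ≤ ouPair (disorderLaw M N) ρ (stablePairs κ (δ * N) a) := by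
  have hNr : (0 : ℝ) < N := by exact_mod_cast hN
  have hround := measurable_roundBits_comp hA
  have hdefect : 0 ≤ 1 - ρ ^ (D + 1) := sub_nonneg.mpr (pow_le_one₀ h0 h1)
  have hτ : 0 < δ * p ^ 2 := by positivity
  have hmarkov := ofReal_mul_lintegral_measure_lt_le (μ := P.prod (roundingLaw N))
    (ν := ouPair (disorderLaw M N) ρ)
    (d := fun w q => (hammingDist (roundBits w.2 (A q.1 w.1)) (roundBits w.2 (A q.2 w.1)) : ℝ))
    (measurable_hammingDist
      (hround.comp (measurable_fst.prodMk (measurable_fst.comp measurable_snd)))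
      (hround.comp (measurable_fst.prodMk (measurable_snd.comp measurable_snd)))) (δ * N)
  have hfar : ∫⁻ w : Ω × (Fin N → ℝ), ouPair (disorderLaw M N) ρ {q | δ * N <
      hammingDist (roundBits w.2 (A q.1 w.1)) (roundBits w.2 (A q.2 w.1))}
      ∂P.prod (roundingLaw N) ≤ ENNReal.ofReal (p ^ 2 / 2) := by
    refine (ENNReal.mul_le_mul_iff_right (ENNReal.ofReal_pos.mpr (by positivity : 0 < δ * N)).ne'
      ENNReal.ofReal_ne_top).mp (hmarkov.trans ?_)
    calc _ ≤ ENNReal.ofReal (N * (δ * p ^ 2) / 4) +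
          ENNReal.ofReal ((1 - ρ ^ (D + 1)) / (2 * (δ * p ^ 2))) * ENNReal.ofReal (B * N) :=
          (lintegral_hammingDist_ouPair_le hA hD h0 h1 hτ).trans (by gcongr)
      _ ≤ ENNReal.ofReal (N * (δ * p ^ 2) / 4) + ENNReal.ofReal (N * (δ * p ^ 2) / 4) := by
          rw [← ENNReal.ofReal_mul (by positivity)]
          gcongr
          rw [div_mul_eq_mul_div, div_le_div_iff₀ (by positivity) (by norm_num)]
          nlinarith
      _ = _ := by
          rw [← ENNReal.ofReal_add (by positivity) (by positivity),
            ← ENNReal.ofReal_mul (by positivity)]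
          congr 1
          ring
  rw [successProb_eq_lintegral hA measurableSet_Ici] at hsucc
  obtain ⟨w, hw⟩ := exists_le_ouPair_stablePairs hround h0 h1 hp.le hsucc hfar
  exact ⟨_, hround.comp measurable_prodMk_left, hw⟩

end Stability

/-! ### Failure of low degree algorithms -/

theorem one_sub_pow_ceil_inv_le_half {ε : ℝ} (h0 : 0 < ε) (h1 : ε ≤ 1) :
    (1 - ε) ^ ⌈ε⁻¹⌉₊ ≤ 1 / 2 := by
  have hone : 1 ≤ ⌈ε⁻¹⌉₊ * ε := by
    rw [← div_le_iff₀ h0, one_div]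
    exact Nat.le_ceil _
  calc (1 - ε) ^ ⌈ε⁻¹⌉₊ ≤ Real.exp (-ε) ^ ⌈ε⁻¹⌉₊ :=
        pow_le_pow_left₀ (sub_nonneg.mpr h1) (Real.one_sub_le_exp_neg ε) _
    _ = Real.exp (-(⌈ε⁻¹⌉₊ * ε)) := by rw [← Real.exp_nat_mul, mul_neg]
    _ ≤ Real.exp (-1) := Real.exp_le_exp.mpr (neg_le_neg hone)
    _ ≤ 1 / 2 := Real.exp_neg_one_lt_half.le

theorem one_sub_one_sub_div_pow_le {θ : ℝ} (hθ : θ ≤ 1) (D : ℕ) :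
    1 - (1 - θ / (D + 1)) ^ (D + 1) ≤ θ := by
  have hD : (0 : ℝ) < D + 1 := by positivity
  have hdiv : θ / (D + 1) ≤ 1 := (div_le_one hD).mpr (by linarith [D.cast_nonneg (α := ℝ)])
  have hbernoulli := one_add_mul_le_pow (a := -(θ / (D + 1))) (by linarith) (D + 1)
  rw [← sub_eq_add_neg, Nat.cast_add_one, mul_neg, mul_div_cancel₀ θ hD.ne'] at hbernoulli
  linarith

theorem two_pow_succ_log_mul_ceil_le {θ : ℝ} (hθ : 0 < θ) {n D : ℕ} :
    (2 : ℝ) ^ (Nat.log 2 (n * ⌈(θ / (D + 1))⁻¹⌉₊)).succ ≤ (2 * n / θ + 2 * n + 2) * (D + 1) := by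
  have hD : (1 : ℝ) ≤ D + 1 := le_add_of_nonneg_left D.cast_nonneg
  set g := ⌈(θ / (D + 1))⁻¹⌉₊
  have hpow : (2 : ℝ) ^ (Nat.log 2 (n * g)).succ ≤ 2 * (n * g + 1) := by
    rw [pow_succ']
    exact_mod_cast Nat.mul_le_mul_left 2 (Nat.pow_log_le_add_one 2 (n * g))
  have hceil : (g : ℝ) ≤ (D + 1) / θ + 1 :=
    (Nat.ceil_lt_add_one (by positivity)).le.trans_eq (by rw [inv_div])
  calc (2 : ℝ) ^ (Nat.log 2 (n * g)).succ ≤ 2 * (n * ((D + 1) / θ + 1) + 1) :=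
        hpow.trans (by gcongr)
    _ = 2 * n / θ * (D + 1) + (2 * n + 2) * 1 := by ring
    _ ≤ 2 * n / θ * (D + 1) + (2 * n + 2) * (D + 1) := by gcongr
    _ = _ := by ring

section FixedDimension

variable {M N : ℕ}

theorem mul_le_of_le_ouPair_stablePairs (hN : 0 < N) {ρ κ δ l r : ℝ} (h0 : 0 ≤ ρ) (h1 : ρ ≤ 1)
    (hκ : κ ≤ 0) (hδ0 : 0 < δ) (hδ1 : 2 * δ ≤ 1) (hl : 0 ≤ l) (hr : 0 < r) {n g k : ℕ}
    (hg : ρ ^ g ≤ 1 - 2 * δ) (hT : n * g ≤ 2 ^ k)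
    (hn : n * Real.exp (-(κ ^ 2 * (1 + δ) / 2)) ≤ (gaussianReal 0 1).real (Set.Iio κ))
    {a : (Fin M → Fin N → ℝ) → Fin N → Bool} (ha : Measurable a)
    (hpair : ENNReal.ofReal r ≤ ouPair (disorderLaw M N) ρ (stablePairs κ (δ * N) a)) :
    M * ((n + 1) * (gaussianReal 0 1).real (Set.Iio κ) / 2) ≤
      N * (Real.log 2 + n * (2 * δ * l + Real.exp (-l))) + n * Real.log (n + 1) +
        (n + 1 - Real.log r) * 2 ^ k := by
  have hpow := (pow_le_pow_left₀ zero_le hpair (2 ^ k)).trans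
    (ouPair_stablePairs_pow_le hN h0 h1 hκ hδ0 hδ1 hl hg hT hn ha)
  rw [← ENNReal.ofReal_pow hr.le, ENNReal.ofReal_le_ofReal_iff (by positivity)] at hpow
  have hlog := Real.log_le_log (by positivity) hpow
  rw [Real.log_pow, Real.log_mul (by positivity) (by positivity), Real.log_exp,
    Real.log_mul (by positivity) (by positivity), Real.log_mul (by positivity) (by positivity),
    Real.log_pow, Real.log_pow, Real.log_pow, Real.log_mul (by positivity) (by positivity),
    Real.log_exp] at hlog
  push_cast at hlog
  have hlogT : Real.log ((2 : ℝ) ^ k + 1) ≤ 2 ^ k :=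
    (Real.log_le_sub_one_of_pos (by positivity)).trans_eq (add_sub_cancel_right _ _)
  have hpaths : ((n : ℝ) + 1) * Real.log (2 ^ k + 1) ≤ (n + 1) * 2 ^ k := by gcongr
  linarith

theorem le_of_successProb {D : ℕ} (hN : 0 < N) {Ω : Type*} [MeasurableSpace Ω]
    {P : Measure Ω} [IsProbabilityMeasure P] {A : (Fin M → Fin N → ℝ) → Ω → Fin N → ℝ}
    (hA : Measurable fun z : (Fin M → Fin N → ℝ) × Ω => A z.1 z.2)
    (hD : IsPolynomialOfDegree D A) {B : ℝ} (hB1 : 1 ≤ B)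
    (hB : secondMoment P A ≤ ENNReal.ofReal (B * N)) {κ p δ l : ℝ} (hκ : κ ≤ 0) (hp0 : 0 < p)
    (hp1 : p ≤ 1) (hδ0 : 0 < δ) (hδ1 : 4 * δ ≤ 1) (hl : 0 ≤ l) {n : ℕ}
    (hn : n * Real.exp (-(κ ^ 2 * (1 + δ) / 2)) ≤ (gaussianReal 0 1).real (Set.Iio κ))
    (hsucc : ENNReal.ofReal p ≤ successProb P A (Set.Ici κ)) :
    M * ((n + 1) * (gaussianReal 0 1).real (Set.Iio κ) / 2) ≤
      N * (Real.log 2 + n * (2 * δ * l + Real.exp (-l))) + n * Real.log (n + 1) +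
        (n + 1 - Real.log (p ^ 2 / 2)) *
          ((2 * n / (δ ^ 2 * p ^ 4 / (2 * B)) + 2 * n + 2) * (D + 1)) := by
  have : 0 < B := one_pos.trans_le hB1
  have hD1 : (1 : ℝ) ≤ D + 1 := le_add_of_nonneg_left D.cast_nonneg
  set θ := δ ^ 2 * p ^ 4 / (2 * B) with hθ
  have hθ0 : 0 < θ := by positivity
  have hθ1 : θ ≤ 1 := by
    rw [hθ, div_le_one (by positivity)]
    have hmul := mul_le_one₀ (pow_le_one₀ hδ0.le (by linarith : δ ≤ 1) (n := 2)) (by positivity)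
      (pow_le_one₀ hp0.le hp1 (n := 4))
    linarith
  set ε := θ / (D + 1)
  have hε0 : 0 < ε := by positivity
  have hε1 : ε ≤ 1 := (div_le_one (by positivity)).mpr (hθ1.trans hD1)
  have hdefect : 2 * B * (1 - (1 - ε) ^ (D + 1)) ≤ δ ^ 2 * p ^ 4 := by
    rw [← le_div_iff₀' (by positivity)]
    exact one_sub_one_sub_div_pow_le hθ1 D
  obtain ⟨a, ha, hpair⟩ := exists_stable_of_successProb hN hA hD hB hp0 hδ0
    (sub_nonneg.mpr hε1) (sub_le_self 1 hε0.le) hdefect hsucc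
  set g := ⌈ε⁻¹⌉₊
  have hg : (1 - ε) ^ g ≤ 1 - 2 * δ := (one_sub_pow_ceil_inv_le_half hε0 hε1).trans (by linarith)
  set k := (Nat.log 2 (n * g)).succ
  have htime : (2 : ℝ) ^ k ≤ (2 * n / θ + 2 * n + 2) * (D + 1) := two_pow_succ_log_mul_ceil_le hθ0
  have hlog : Real.log (p ^ 2 / 2) ≤ 0 := Real.log_nonpos (by positivity) (by nlinarith)
  refine (mul_le_of_le_ouPair_stablePairs hN (sub_nonneg.mpr hε1) (sub_le_self 1 hε0.le) hκ hδ0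
    (by linarith) hl (by positivity) hg (Nat.lt_pow_succ_log_self one_lt_two _).le hn ha
    hpair).trans ?_
  have hfactor : 0 ≤ n + 1 - Real.log (p ^ 2 / 2) := by linarith [n.cast_nonneg (α := ℝ)]
  gcongr

end FixedDimension

theorem tendsto_successProb_zero {κ α δ l : ℝ} (hκ : κ ≤ 0) (hδ0 : 0 < δ) (hδ1 : 4 * δ ≤ 1)
    (hl : 0 ≤ l) {n : ℕ}
    (hn : n * Real.exp (-(κ ^ 2 * (1 + δ) / 2)) ≤ (gaussianReal 0 1).real (Set.Iio κ))
    (hgap : Real.log 2 + n * (2 * δ * l + Real.exp (-l)) <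
      α * ((n + 1) * (gaussianReal 0 1).real (Set.Iio κ) / 2))
    {M : ℕ → ℕ} (hM : Tendsto (fun N => (M N : ℝ) / N) atTop (𝓝 α)) {D : ℕ → ℕ}
    (hD : (fun N => (D N : ℝ)) =o[atTop] (fun N : ℕ => (N : ℝ)))
    {Ω : ℕ → Type*} [∀ N, MeasurableSpace (Ω N)] {P : ∀ N, Measure (Ω N)}
    [∀ N, IsProbabilityMeasure (P N)] {A : ∀ N, (Fin (M N) → Fin N → ℝ) → Ω N → Fin N → ℝ}
    (hA : ∀ N, Measurable fun z : (Fin (M N) → Fin N → ℝ) × Ω N => A N z.1 z.2)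
    (hpoly : ∀ N, IsPolynomialOfDegree (D N) (A N))
    (hB : ∃ B : ℝ, ∀ᶠ N : ℕ in atTop, secondMoment (P N) (A N) ≤ ENNReal.ofReal (B * N)) :
    Tendsto (fun N => successProb (P N) (A N) (Set.Ici κ)) atTop (𝓝 0) := by
  rw [ENNReal.tendsto_nhds_zero]
  intro e he
  obtain ⟨p, hp0, hp⟩ : ∃ p : NNReal, 0 < p ∧ (p : ENNReal) < min e 1 :=
    ENNReal.lt_iff_exists_nnreal_btwn.mp (lt_min he one_pos) |>.imp fun p h => by simpa using h
  obtain ⟨hpe, hp1⟩ := lt_min_iff.mp hp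
  obtain ⟨B, hB⟩ := hB
  set q := (gaussianReal 0 1).real (Set.Iio κ)
  set c := ((n : ℝ) + 1 - Real.log (p ^ 2 / 2)) *
    (2 * n / (δ ^ 2 * p ^ 4 / (2 * max B 1)) + 2 * n + 2) with hc
  have hlim : Tendsto (fun N : ℕ => (M N : ℝ) / N * ((n + 1) * q / 2) -
      (n * Real.log (n + 1) + c) / N - c * (D N / N)) atTop
      (𝓝 (α * ((n + 1) * q / 2) - 0 - c * 0)) :=
    ((hM.mul_const _).sub (tendsto_const_div_atTop_nhds_zero_nat _)).sub
      (hD.tendsto_div_nhds_zero.const_mul c)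
  rw [mul_zero, sub_zero, sub_zero] at hlim
  filter_upwards [hlim.eventually (lt_mem_nhds hgap), hB, eventually_gt_atTop 0]
    with N hgapN hBN hN
  by_contra! hsucc
  have hN0 : (0 : ℝ) < N := by exact_mod_cast hN
  have hmoment : secondMoment (P N) (A N) ≤ ENNReal.ofReal (max B 1 * N) :=
    hBN.trans (by gcongr; exact le_max_left B 1)
  have hbound := le_of_successProb hN (hA N) (hpoly N) (le_max_right B 1) hmoment hκ
    (NNReal.coe_pos.mpr hp0) (by exact_mod_cast hp1.le) hδ0 hδ1 hl hn
    ((ENNReal.ofReal_coe_nnreal.trans_lt (hpe.trans hsucc)).le)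
  rw [← mul_assoc, ← hc] at hbound
  have hgapN' := mul_lt_mul_of_pos_right hgapN hN0
  field_simp at hgapN'
  linarith

/-! ### The admissible densities -/

theorem exp_div_twenty_le_gaussianPDFReal {x y : ℝ} (h : x ^ 2 ≤ y ^ 2 + 3) :
    Real.exp (-(y ^ 2 / 2)) / 20 ≤ gaussianPDFReal 0 1 x := by
  have hsqrt : √(2 * Real.pi) ≤ 2.6 := by
    rw [Real.sqrt_le_left (by norm_num)]
    linarith [Real.pi_lt_d2]
  have hexp : Real.exp (3 / 2) ≤ 7.4 := by
    calc Real.exp (3 / 2) ≤ Real.exp (1 + 1) := by gcongr; norm_num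
      _ = Real.exp 1 * Real.exp 1 := Real.exp_add 1 1
      _ ≤ 2.72 * 2.72 := by gcongr <;> linarith [Real.exp_one_lt_d9]
      _ ≤ 7.4 := by norm_num
  calc Real.exp (-(y ^ 2 / 2)) / 20
      ≤ Real.exp (-(y ^ 2 / 2)) / (√(2 * Real.pi) * Real.exp (3 / 2)) := by
        gcongr
        nlinarith [Real.sqrt_nonneg (2 * Real.pi), Real.exp_pos (3 / 2)]
    _ = (√(2 * Real.pi))⁻¹ * Real.exp (-(y ^ 2 / 2) - 3 / 2) := by
        rw [Real.exp_sub, inv_mul_eq_div, div_div, mul_comm]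
    _ ≤ (√(2 * Real.pi))⁻¹ * Real.exp (-(x ^ 2 / 2)) := by gcongr; linarith
    _ = gaussianPDFReal 0 1 x := by simp [gaussianPDFReal, neg_div]

theorem exp_div_le_gaussianReal_Iio {κ : ℝ} (hκ : κ ≤ -1) :
    Real.exp (-(κ ^ 2 / 2)) / (20 * |κ|) ≤ (gaussianReal 0 1).real (Set.Iio κ) := by
  have hκ0 : κ < 0 := by linarith
  have habs : 0 < |κ| := abs_pos.mpr hκ0.ne
  have hnear {x : ℝ} (hx : x ∈ Set.Ioo (κ - |κ|⁻¹) κ) : x ^ 2 ≤ κ ^ 2 + 3 := by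
    have hinv : |κ|⁻¹ ≤ 1 := inv_le_one_of_one_le₀ (by rw [abs_of_neg hκ0]; linarith)
    have hprod : κ * |κ|⁻¹ = -1 := by
      rw [abs_of_neg hκ0, inv_neg, mul_neg, mul_inv_cancel₀ hκ0.ne]
    nlinarith [hx.1, hx.2, inv_pos.mpr habs]
  rw [measureReal_def, ← ENNReal.ofReal_le_iff_le_toReal (measure_ne_top _ _),
    gaussianReal_apply 0 one_ne_zero]
  calc ENNReal.ofReal (Real.exp (-(κ ^ 2 / 2)) / (20 * |κ|))
      = ENNReal.ofReal (Real.exp (-(κ ^ 2 / 2)) / 20) * volume (Set.Ioo (κ - |κ|⁻¹) κ) := by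
        rw [Real.volume_Ioo, sub_sub_cancel, ← ENNReal.ofReal_mul (by positivity), ← div_eq_mul_inv,
          div_div]
    _ = ∫⁻ _ in Set.Ioo (κ - |κ|⁻¹) κ, ENNReal.ofReal (Real.exp (-(κ ^ 2 / 2)) / 20) :=
        (setLIntegral_const _ _).symm
    _ ≤ ∫⁻ x in Set.Ioo (κ - |κ|⁻¹) κ, gaussianPDF 0 1 x :=
        setLIntegral_mono (measurable_gaussianPDF 0 1) fun x hx =>
          ENNReal.ofReal_le_ofReal (exp_div_twenty_le_gaussianPDFReal (hnear hx))
    _ ≤ ∫⁻ x in Set.Iio κ, gaussianPDF 0 1 x := lintegral_mono_set fun x hx => hx.2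

theorem div_sq_le_mul_gaussianReal_Iio {κ α c : ℝ} (hκ : κ ≤ -1) (hc : 0 ≤ c)
    (hα : 4000 * Real.exp (κ ^ 2 / 2) * c / |κ| ≤ α) :
    200 * c / κ ^ 2 ≤ α * (gaussianReal 0 1).real (Set.Iio κ) := by
  have habs : |κ| ≠ 0 := abs_ne_zero.mpr (by linarith)
  calc 200 * c / κ ^ 2 = (4000 * Real.exp (κ ^ 2 / 2) * c / |κ|) *
        (Real.exp (-(κ ^ 2 / 2)) / (20 * |κ|)) := by
        rw [Real.exp_neg, ← sq_abs κ]
        field_simp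
        ring
    _ ≤ α * (gaussianReal 0 1).real (Set.Iio κ) := by
        have hα0 : 0 ≤ α := le_trans (by positivity) hα
        gcongr
        exact exp_div_le_gaussianReal_Iio hκ

section ClusterParameters

variable {x b : ℝ}

theorem floor_sq_mul_exp_le (hx : 0 < x) (hb : 1 ≤ b) (hxb : Real.log x ≤ b) :
    ⌊x ^ 2⌋₊ * Real.exp (-(x ^ 2 * (1 + 20 * b / x ^ 2) / 2)) ≤
      Real.exp (-(x ^ 2 / 2)) / (20 * x) := by
  have hcube : 20 * x ^ 3 ≤ Real.exp (10 * b) :=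
    calc 20 * x ^ 3 ≤ 2 ^ 7 * x ^ 3 := by gcongr; norm_num
      _ ≤ Real.exp b ^ 7 * Real.exp b ^ 3 := by
          gcongr
          · linarith [Real.add_one_le_exp b]
          · exact (Real.log_le_iff_le_exp hx).mp hxb
      _ = Real.exp (10 * b) := by rw [← pow_add, ← Real.exp_nat_mul]; norm_num
  calc ⌊x ^ 2⌋₊ * Real.exp (-(x ^ 2 * (1 + 20 * b / x ^ 2) / 2))
      = ⌊x ^ 2⌋₊ * (Real.exp (-(x ^ 2 / 2)) / Real.exp (10 * b)) := by
        rw [← Real.exp_sub]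
        congr 2
        field_simp
        ring
    _ ≤ x ^ 2 * (Real.exp (-(x ^ 2 / 2)) / (20 * x ^ 3)) := by
        gcongr
        exact Nat.floor_le (sq_nonneg x)
    _ = _ := by field_simp

theorem log_two_add_floor_sq_mul_lt (hx : 1 ≤ x) (hb : 1 ≤ b) (hxb : Real.log x ≤ b) :
    Real.log 2 + ⌊x ^ 2⌋₊ * (2 * (20 * b / x ^ 2) * (2 * Real.log x) + Real.exp (-(2 * Real.log x)))
      < (⌊x ^ 2⌋₊ + 1) * (200 * b ^ 2 / x ^ 2) / 2 := by
  have hx0 : 0 < x := one_pos.trans_le hx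
  have hsq : 1 ≤ b ^ 2 := one_le_pow₀ hb
  have hexp : Real.exp (-(2 * Real.log x)) = 1 / x ^ 2 := by
    rw [Real.exp_neg, two_mul, Real.exp_add, Real.exp_log hx0, ← sq, one_div]
  have hentropy : 2 * (20 * b / x ^ 2) * (2 * Real.log x) + Real.exp (-(2 * Real.log x)) ≤
      81 * (b ^ 2 / x ^ 2) := by
    calc _ = (80 * (b * Real.log x) + 1) / x ^ 2 := by rw [hexp]; ring
      _ ≤ (80 * (b * b) + b ^ 2) / x ^ 2 := by gcongr
      _ = _ := by ring
  have hone : 1 ≤ (⌊x ^ 2⌋₊ + 1) * (b ^ 2 / x ^ 2) := by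
    rw [mul_div_assoc', le_div_iff₀ (by positivity)]
    nlinarith [Nat.lt_floor_add_one (x ^ 2)]
  have hsum := mul_le_mul_of_nonneg_left hentropy ⌊x ^ 2⌋₊.cast_nonneg
  have hratio : 0 ≤ b ^ 2 / x ^ 2 := by positivity
  rw [mul_div_assoc 200]
  linarith [Real.log_two_lt_d9]

end ClusterParameters

/-- For large `|κ|` clusters of `κ²` solutions are used; when `κ²` is at most a multiple of
`max 1 (log |κ|)`, the expected number of single solutions already tends to `0`. -/
theorem exists_cluster_parameters {κ α : ℝ} (hκ : κ ≤ -1)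
    (hα : 4000 * Real.exp (κ ^ 2 / 2) * max 1 (Real.log |κ| ^ 2) / |κ| ≤ α) :
    ∃ (n : ℕ) (δ l : ℝ), 0 < δ ∧ 4 * δ ≤ 1 ∧ 0 ≤ l ∧
      n * Real.exp (-(κ ^ 2 * (1 + δ) / 2)) ≤ (gaussianReal 0 1).real (Set.Iio κ) ∧
      Real.log 2 + n * (2 * δ * l + Real.exp (-l)) <
        α * ((n + 1) * (gaussianReal 0 1).real (Set.Iio κ) / 2) := by
  have hx1 : 1 ≤ |κ| := by rw [abs_of_neg (by linarith)]; linarith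
  have hx0 : 0 < |κ| := one_pos.trans_le hx1
  have hlog : 0 ≤ Real.log |κ| := Real.log_nonneg hx1
  have htail := exp_div_le_gaussianReal_Iio hκ
  have hdensity := div_sq_le_mul_gaussianReal_Iio hκ (zero_le_one.trans (le_max_left _ _)) hα
  set b := max 1 (Real.log |κ|)
  have hb : 1 ≤ b := le_max_left _ _
  have hmax : max 1 (Real.log |κ| ^ 2) = b ^ 2 := by
    rw [← one_pow 2]
    exact ((pow_left_monotoneOn (n := 2)).map_max zero_le_one hlog).symm
  set q := (gaussianReal 0 1).real (Set.Iio κ)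
  rw [hmax, ← sq_abs κ] at hdensity
  rw [← sq_abs] at htail
  rw [← sq_abs]
  rcases le_or_gt (80 * b) (|κ| ^ 2) with hlarge | hsmall
  · refine ⟨⌊|κ| ^ 2⌋₊, 20 * b / |κ| ^ 2, 2 * Real.log |κ|, by positivity, ?_, by positivity,
      (floor_sq_mul_exp_le hx0 hb (le_max_right _ _)).trans htail, ?_⟩
    · rw [← mul_div_assoc, div_le_one (by positivity)]
      linarith
    · calc _ < (⌊|κ| ^ 2⌋₊ + 1) * (200 * b ^ 2 / |κ| ^ 2) / 2 :=
            log_two_add_floor_sq_mul_lt hx1 hb (le_max_right _ _)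
        _ ≤ (⌊|κ| ^ 2⌋₊ + 1) * (α * q) / 2 := by gcongr
        _ = _ := by ring
  · have hfirst : 2 ≤ 200 * b ^ 2 / |κ| ^ 2 := by
      rw [le_div_iff₀ (by positivity)]
      nlinarith
    refine ⟨0, 1 / 4, 0, by norm_num, by norm_num, le_rfl, by simp [q], ?_⟩
    simp only [Nat.cast_zero, zero_mul, add_zero, zero_add, one_mul]
    linarith [Real.log_two_lt_d9]

theorem isBigO_div_log_natCast :
    (fun N : ℕ => (N : ℝ) / Real.log N) =O[atTop] fun N : ℕ => (N : ℝ) := by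
  refine IsBigO.of_bound 1 ?_
  filter_upwards [eventually_ge_atTop 3] with N hN
  have hN3 : (3 : ℝ) ≤ N := by exact_mod_cast hN
  have hlog : 1 ≤ Real.log N := by
    rw [Real.le_log_iff_exp_le (by linarith)]
    linarith [Real.exp_one_lt_d9]
  rw [one_mul, norm_div, Real.norm_of_nonneg (zero_le_one.trans hlog)]
  exact div_le_self (norm_nonneg _) hlog

end IsingPerceptron

end

theorem corollary3p9_general :
    ∃ C : ℝ, 0 < C ∧ ∀ κ α : ℝ, κ ≤ -1 →
      C * Real.exp (κ ^ 2 / 2) * max 1 (Real.log |κ| ^ 2) / |κ| ≤ α →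
      ∀ M : ℕ → ℕ, Tendsto (fun N => (M N : ℝ) / N) atTop (𝓝 α) →
      ∀ D : ℕ → ℕ, (fun N => (D N : ℝ)) =o[atTop] (fun N : ℕ => (N : ℝ)) →
      ∀ (Ω : ℕ → Type*) [∀ N, MeasurableSpace (Ω N)] (P : ∀ N, Measure (Ω N))
        [∀ N, IsProbabilityMeasure (P N)]
        (A : ∀ N, (Fin (M N) → Fin N → ℝ) → Ω N → Fin N → ℝ),
        (∀ N, Measurable fun z : (Fin (M N) → Fin N → ℝ) × Ω N => A N z.1 z.2) →
        (∀ N, IsingPerceptron.IsPolynomialOfDegree (D N) (A N)) →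
        (∃ B : ℝ, ∀ᶠ N : ℕ in atTop,
          IsingPerceptron.secondMoment (P N) (A N) ≤ ENNReal.ofReal (B * N)) →
        Tendsto (fun N => IsingPerceptron.successProb (P N) (A N) (Set.Ici κ)) atTop (𝓝 0) := by
  refine ⟨4000, by norm_num, fun κ α hκ hα M hM D hD Ω _ P _ A hA hpoly hB => ?_⟩
  obtain ⟨n, δ, l, hδ0, hδ1, hl, hn, hgap⟩ := IsingPerceptron.exists_cluster_parameters hκ hα
  exact IsingPerceptron.tendsto_successProb_zero (by linarith) hδ0 hδ1 hl hn hgap hM hD hA hpoly hB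

theorem corollary3p9 :
    ∃ C : ℝ, 0 < C ∧ ∀ κ α : ℝ, κ ≤ -1 →
      C * Real.exp (κ ^ 2 / 2) * max 1 (Real.log |κ| ^ 2) / |κ| ≤ α →
      ∀ M : ℕ → ℕ, Tendsto (fun N => (M N : ℝ) / N) atTop (𝓝 α) →
      ∀ D : ℕ → ℕ, (fun N => (D N : ℝ)) =o[atTop] (fun N : ℕ => (N : ℝ) / Real.log N) →
      ∀ (Ω : ℕ → Type*) [∀ N, MeasurableSpace (Ω N)] (P : ∀ N, Measure (Ω N))
        [∀ N, IsProbabilityMeasure (P N)]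
        (A : ∀ N, (Fin (M N) → Fin N → ℝ) → Ω N → Fin N → ℝ),
        (∀ N, Measurable fun z : (Fin (M N) → Fin N → ℝ) × Ω N => A N z.1 z.2) →
        (∀ N, IsingPerceptron.IsPolynomialOfDegree (D N) (A N)) →
        (∃ B : ℝ, ∀ᶠ N : ℕ in atTop,
          IsingPerceptron.secondMoment (P N) (A N) ≤ ENNReal.ofReal (B * N)) →
        Tendsto (fun N => IsingPerceptron.successProb (P N) (A N) (Set.Ici κ)) atTop (𝓝 0) := by
  obtain ⟨C, hC, h⟩ := corollary3p9_general
  exact ⟨C, hC, fun κ α hκ hα M hM D hD =>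
    h κ α hκ hα M hM D (hD.trans_isBigO IsingPerceptron.isBigO_div_log_natCast)⟩
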